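/- Let $\mathbb K$ be a field of characteristic $0$. A graph over a finite set $V$ is a multiset of two-element subsets of $V$ (its edges; parallel edges allowed, no loops). The Hopf monoid $\mathbf G$ of graphs has $\mathbf G[V]$ with basis the graphs over $V$, product $g_1\otimes g_2\mapsto g_1\sqcup g_2$ and coproduct $\Delta_{V_1,V_2}(g)=g|_{V_1}\otimes g|_{V_2}$, where $g|_A$ consists of the edges of $g$ contained in $A$. A character $\zeta$ of $\mathbf G$ is a family of linear maps $\zeta_V:\mathbf G[V]\to\mathbb K$, multiplicative for the product and sending the unit to $1$; it is a characteristic function if $\zeta(g)\in\{0,1\}$ for every graph $g$, and odd if every connected graph $g$ with $\zeta(g)\neq 0$ has an odd number of vertices. For $n\ge 0$ put $$\chi^\zeta_V(g)(n)=\sum_{V=V_1\sqcup\dots\sqcup V_n}\zeta_V\circ\mu_{V_1,\dots,V_n}\circ\Delta_{V_1,\dots,V_n}(g),$$ the sum being over decompositions with possibly empty parts. A partial orientation $f$ of $g$ assigns to some of the edges $e$ (each of several parallel edges counts separately) one of the ends $f(e)\in e$; $f(g)$ is the graph over $V$ formed by the non-oriented edges. It is discrete if all edges are oriented, and acyclic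 if there is no directed cycle containing at least one oriented edge, where oriented edges are followed towards $f(e)$ and non-oriented edges may be followed both ways. Let $\mathcal A_g$ be the set of acyclic partial orientations of $g$. A coloring $c:V\to[n]$ is compatible with $f$ if it is constant on each non-oriented edge and $f(e)$ has maximal color in $e$ for each oriented edge $e$; it is strictly compatible if moreover $f(e)$ is the only vertex of maximal color in each oriented edge $e$. Write $C_{g,f,n}$ and $C^\circ_{g,f,n}$ for the sets of compatible and of strictly compatible colorings. A flat of $g$ is a subgraph over $V$ of the form $F=g|_{D_1}\sqcup\dots\sqcup g|_{D_k}$ with $V=D_1\sqcup\dots\sqcup D_k$ and all $D_i\ne\emptyset$; $g/F$ is obtained by deleting the edges of $F$ and merging the vertices in the same connected component of $F$; $\mathcal A^{d}_{g/F}$ is the set of discrete acyclic orientations of $g/F$. Finally $\mathrm{cc}$ denotes the number of connected components, isolated vertices included. **Proposition.** Let $\zeta$ be a character of $\mathbf G$, $V$ a finite set and $g$ a graph over $V$. For all integers $n\ge 0$, $$\chi^\zeta_V(g)(n)=\sum_{f\in\mathcal A_g}\zeta(f(g))\,|C^\circ_{g,f,n}|=\sum_{F\in\mathrm{Flats}(g)}\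 \sum_{a\in\mathcal A^{d}_{g/F}}\zeta(F)\,|C^\circ_{g/F,a,n}|.$$ There is a (necessarily unique) polynomial with coefficients in $\mathbb K$ whose value at every $n\in\mathbb N$ is $\chi^\zeta_V(g)(n)$; denoting its value at $-n$ by $\chi^\zeta_V(g)(-n)$, for all integers $n\ge 0$, $$\chi^\zeta_V(g)(-n)=\sum_{f\in\mathcal A_g}(-1)^{\mathrm{cc}(f(g))}\zeta(f(g))\,|C_{g,f,n}|=\sum_{F\in\mathrm{Flats}(g)}\ \sum_{a\in\mathcal A^{d}_{g/F}}(-1)^{\mathrm{cc}(F)}\zeta(F)\,|C_{g/F,a,n}|.$$ If $\zeta$ is a characteristic function, then $\chi^\zeta_V(g)(n)$ is the number of pairs $(f,c)$ of an acyclic partial orientation $f$ of $g$ with $\zeta(f(g))\ne 0$ and a coloring $c:V\to[n]$ strictly compatible with $f$. If moreover $\zeta$ is odd, then $(-1)^{|V|}\chi^\zeta_V(g)(-n)$ is the number of such pairs with $c$ compatible with $f$; in particular $(-1)^{|V|}\chi^\zeta_V(g)(-1)$ is the number of acyclic partial orientations $f$ of $g$ with $\zeta(f(g))\neq 0$. 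-/

import Mathlib

open scoped TensorProduct Polynomial

universe u v w

namespace GraphHopf

/-! ## Finite sets, splittings and decompositions

A finite set is a `Finset` of an arbitrary type of the universe `u`. -/

/-- `V = A ⊔ B`. -/
structure IsSplit {α : Type u} (A B V : Finset α) : Prop where
  disj : Disjoint A B
  mem_iff : ∀ a, a ∈ V ↔ a ∈ A ∨ a ∈ B

/-- A decomposition `V = V₁ ⊔ ⋯ ⊔ Vₙ` of length `n`; parts may be empty. -/
structure Decomposition {α : Type u} (V : Finset α) (n : ℕ) where
  parts : Fin n → Finset α
  disj : ∀ i j, i ≠ j → Disjoint (parts i) (parts j)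
  mem_iff : ∀ a, a ∈ V ↔ ∃ i, a ∈ parts i

/-- A composition is a decomposition without empty parts. -/
def Decomposition.IsComposition {α : Type u} {V : Finset α} {n : ℕ}
    (D : Decomposition V n) : Prop :=
  ∀ i, (D.parts i).Nonempty

theorem Decomposition.parts_injective {α : Type u} (V : Finset α) (n : ℕ) :
    Function.Injective (fun D : Decomposition V n => D.parts) := by
  rintro ⟨p, _, _⟩ ⟨q, _, _⟩ h
  cases h
  rfl

instance {α : Type u} (V : Finset α) (n : ℕ) : Finite (Decomposition V n) := by
  refine Finite.of_injective
    (fun (D : Decomposition V n) (i : Fin n) =>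
      (⟨D.parts i, Finset.mem_powerset.2 fun a ha => (D.mem_iff a).2 ⟨i, ha⟩⟩ :
        {s : Finset α // s ∈ V.powerset})) ?_
  intro D D' h
  apply Decomposition.parts_injective
  funext i
  exact congrArg Subtype.val (congrFun h i)

noncomputable instance {α : Type u} (V : Finset α) (n : ℕ) : Fintype (Decomposition V n) :=
  Fintype.ofFinite _

open scoped Classical in
/-- `(V₂, …, Vₙ₊₁)` as a decomposition of `V ∖ V₁`. -/
noncomputable def Decomposition.tail {α : Type u} {V : Finset α} {n : ℕ}
    (D : Decomposition V (n + 1)) : Decomposition (V \ D.parts 0) n where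
  parts i := D.parts i.succ
  disj i j hij := D.disj _ _ fun h => hij (Fin.succ_injective _ h)
  mem_iff a := by
    rw [Finset.mem_sdiff, D.mem_iff]
    constructor
    · rintro ⟨⟨i, hi⟩, h0⟩
      induction i using Fin.cases with
      | zero => exact absurd hi h0
      | succ i => exact ⟨i, hi⟩
    · rintro ⟨i, hi⟩
      exact ⟨⟨_, hi⟩, fun h0 =>
        Finset.disjoint_left.1 (D.disj _ _ (Fin.succ_ne_zero i)) hi h0⟩

open scoped Classical in
theorem Decomposition.isSplit {α : Type u} {V : Finset α} {n : ℕ}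
    (D : Decomposition V (n + 1)) : IsSplit (D.parts 0) (V \ D.parts 0) V where
  disj := Finset.disjoint_sdiff
  mem_iff a := by
    have h : a ∈ D.parts 0 → a ∈ V := fun h => (D.mem_iff a).2 ⟨0, h⟩
    rw [Finset.mem_sdiff]
    tauto

/-! ## Hopf monoids, characters and polynomial invariants -/

set_option linter.checkUnivs false in
/-- A connected Hopf monoid in linear species over `K`. -/
structure HopfMonoid (K : Type w) [Field K] where
  obj : {α : Type u} → Finset α → Type v
  addCommGroup : ∀ {α : Type u} (V : Finset α), AddCommGroup (obj V)
  module : ∀ {α : Type u} (V : Finset α), Module K (obj V)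
  /-- the action of bijections -/
  map : ∀ {α β : Type u} {V : Finset α} {W : Finset β}, (V ≃ W) → (obj V →ₗ[K] obj W)
  map_refl : ∀ {α : Type u} (V : Finset α), map (Equiv.refl V) = LinearMap.id
  map_trans : ∀ {α β γ : Type u} {V : Finset α} {W : Finset β} {X : Finset γ}
    (σ : V ≃ W) (τ : W ≃ X), map (σ.trans τ) = map τ ∘ₗ map σ
  /-- the identification of `K` with the component of the empty set -/
  unit : ∀ α : Type u, K ≃ₗ[K] obj (∅ : Finset α)
  map_unit : ∀ {α β : Type u} (σ : (∅ : Finset α) ≃ (∅ : Finset β)) (r : K),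
    map σ (unit α r) = unit β r
  /-- the product -/
  mul : ∀ {α : Type u} {A B V : Finset α}, IsSplit A B V → (obj A ⊗[K] obj B →ₗ[K] obj V)
  /-- the coproduct -/
  comul : ∀ {α : Type u} {A B V : Finset α}, IsSplit A B V → (obj V →ₗ[K] obj A ⊗[K] obj B)
  map_mul : ∀ {α β : Type u} {A B V : Finset α} {A' B' V' : Finset β}
    (h : IsSplit A B V) (h' : IsSplit A' B' V') (σ : V ≃ V') (σA : A ≃ A') (σB : B ≃ B'),
    (∀ (a : α) (ha : a ∈ A) (hV : a ∈ V), (σ ⟨a, hV⟩ : β) = σA ⟨a, ha⟩) →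
    (∀ (b : α) (hb : b ∈ B) (hV : b ∈ V), (σ ⟨b, hV⟩ : β) = σB ⟨b, hb⟩) →
    map σ ∘ₗ mul h = mul h' ∘ₗ TensorProduct.map (map σA) (map σB)
  map_comul : ∀ {α β : Type u} {A B V : Finset α} {A' B' V' : Finset β}
    (h : IsSplit A B V) (h' : IsSplit A' B' V') (σ : V ≃ V') (σA : A ≃ A') (σB : B ≃ B'),
    (∀ (a : α) (ha : a ∈ A) (hV : a ∈ V), (σ ⟨a, hV⟩ : β) = σA ⟨a, ha⟩) →
    (∀ (b : α) (hb : b ∈ B) (hV : b ∈ V), (σ ⟨b, hV⟩ : β) = σB ⟨b, hb⟩) →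
    comul h' ∘ₗ map σ = TensorProduct.map (map σA) (map σB) ∘ₗ comul h
  mul_unit : ∀ {α : Type u} {V : Finset α} (h : IsSplit V ∅ V) (x : obj V),
    mul h (x ⊗ₜ unit α 1) = x
  unit_mul : ∀ {α : Type u} {V : Finset α} (h : IsSplit ∅ V V) (x : obj V),
    mul h (unit α 1 ⊗ₜ x) = x
  comul_unit : ∀ {α : Type u} {V : Finset α} (h : IsSplit V ∅ V) (x : obj V),
    comul h x = x ⊗ₜ unit α 1
  unit_comul : ∀ {α : Type u} {V : Finset α} (h : IsSplit ∅ V V) (x : obj V),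
    comul h x = unit α 1 ⊗ₜ x
  mul_assoc : ∀ {α : Type u} {A B C AB BC V : Finset α} (hAB : IsSplit A B AB)
    (hABC : IsSplit AB C V) (hBC : IsSplit B C BC) (hABC' : IsSplit A BC V)
    (x : obj A) (y : obj B) (z : obj C),
    mul hABC' (x ⊗ₜ mul hBC (y ⊗ₜ z)) = mul hABC (mul hAB (x ⊗ₜ y) ⊗ₜ z)
  comul_assoc : ∀ {α : Type u} {A B C AB BC V : Finset α} (hAB : IsSplit A B AB)
    (hABC : IsSplit AB C V) (hBC : IsSplit B C BC) (hABC' : IsSplit A BC V),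
    (TensorProduct.assoc K (obj A) (obj B) (obj C)).toLinearMap ∘ₗ
        TensorProduct.map (comul hAB) LinearMap.id ∘ₗ comul hABC
      = TensorProduct.map LinearMap.id (comul hBC) ∘ₗ comul hABC'
  /-- here `V = V₁ ⊔ V₂ = V₃ ⊔ V₄` and `Vᵢⱼ = Vᵢ ∩ Vⱼ` -/
  compat : ∀ {α : Type u} {V V₁ V₂ V₃ V₄ V₁₃ V₁₄ V₂₃ V₂₄ : Finset α}
    (h₁₂ : IsSplit V₁ V₂ V) (h₃₄ : IsSplit V₃ V₄ V) (h₁ : IsSplit V₁₃ V₁₄ V₁)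
    (h₂ : IsSplit V₂₃ V₂₄ V₂) (h₃ : IsSplit V₁₃ V₂₃ V₃) (h₄ : IsSplit V₁₄ V₂₄ V₄),
    comul h₃₄ ∘ₗ mul h₁₂
      = TensorProduct.map (mul h₃) (mul h₄) ∘ₗ
        (TensorProduct.tensorTensorTensorComm K
          (obj V₁₃) (obj V₁₄) (obj V₂₃) (obj V₂₄)).toLinearMap ∘ₗ
        TensorProduct.map (comul h₁) (comul h₂)

attribute [instance] HopfMonoid.addCommGroup HopfMonoid.module

/-- A character of a Hopf monoid: linear maps `M[V] → K`, multiplicative and unital. -/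
structure HopfMonoid.Character {K : Type w} [Field K] (M : HopfMonoid.{u, v, w} K) where
  toFun : ∀ {α : Type u} (V : Finset α), M.obj V →ₗ[K] K
  map_unit : ∀ α : Type u, toFun (∅ : Finset α) (M.unit α 1) = 1
  map_mul : ∀ {α : Type u} {A B V : Finset α} (h : IsSplit A B V) (x : M.obj A) (y : M.obj B),
    toFun V (M.mul h (x ⊗ₜ y)) = toFun A x * toFun B y

/-- The endomorphism `μ_D ∘ Δ_D` of `M[V]` for a decomposition `D = (V₁, …, Vₙ)` of `V`:
split off `V₁`, iterate on the rest, and merge again. For `n = 0` (so `V = ∅`) it is the identity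
of `M[∅]`. -/
noncomputable def HopfMonoid.mulComul {K : Type w} [Field K] (M : HopfMonoid.{u, v, w} K)
    {α : Type u} : (n : ℕ) → {V : Finset α} → Decomposition V n → (M.obj V →ₗ[K] M.obj V)
  | 0, _, _ => LinearMap.id
  | n + 1, _, D =>
    M.mul D.isSplit ∘ₗ TensorProduct.map LinearMap.id (M.mulComul n D.tail) ∘ₗ M.comul D.isSplit

/-- The invariant `χ^ζ_V(x)(n) = ∑_{V = V₁ ⊔ ⋯ ⊔ Vₙ} ζ_V (μ_D (Δ_D x))`. -/
noncomputable def HopfMonoid.chi {K : Type w} [Field K] (M : HopfMonoid.{u, v, w} K)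
    (ζ : M.Character) {α : Type u} {V : Finset α} (x : M.obj V) (n : ℕ) : K :=
  ∑ D : Decomposition V n, ζ.toFun V (M.mulComul n D x)

/-! ## The Hopf monoid of graphs -/

/-- A graph over `V`: a multiset of two-element subsets of `V`. -/
@[ext]
structure Multigraph {α : Type u} (V : Finset α) where
  edges : Multiset (Finset α)
  subset : ∀ e ∈ edges, e ⊆ V
  card_eq : ∀ e ∈ edges, e.card = 2

namespace Multigraph

variable {α β γ : Type u}

/-- The disjoint union of a graph over `A` and a graph over `B`. -/
def union {A B V : Finset α} (h : IsSplit A B V) (g₁ : Multigraph A) (g₂ : Multigraph B) :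
    Multigraph V where
  edges := g₁.edges + g₂.edges
  subset e he a ha := by
    rcases Multiset.mem_add.1 he with he | he
    · exact (h.mem_iff a).2 (Or.inl (g₁.subset e he ha))
    · exact (h.mem_iff a).2 (Or.inr (g₂.subset e he ha))
  card_eq e he := by
    rcases Multiset.mem_add.1 he with he | he
    · exact g₁.card_eq e he
    · exact g₂.card_eq e he

open scoped Classical in
/-- The induced subgraph `g|_A`. -/
noncomputable def restrict {V : Finset α} (g : Multigraph V) (A : Finset α) : Multigraph A where
  edges := g.edges.filter fun e => e ⊆ A
  subset _ he := (Multiset.mem_filter.1 he).2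
  card_eq e he := g.card_eq e (Multiset.mem_filter.1 he).1

open scoped Classical in
/-- The image of a subset `e` of `V` under a bijection `V ≃ W`. -/
noncomputable def mapEdge {V : Finset α} {W : Finset β} (σ : V ≃ W) (e : Finset α) : Finset β :=
  (e.subtype (· ∈ V)).map (σ.toEmbedding.trans (Function.Embedding.subtype _))

theorem mem_mapEdge {V : Finset α} {W : Finset β} (σ : V ≃ W) (e : Finset α) (b : β) :
    b ∈ mapEdge σ e ↔ ∃ (a : α) (ha : a ∈ V), a ∈ e ∧ (σ ⟨a, ha⟩ : β) = b := by
  simp [mapEdge]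

/-- Relabelling the vertices along a bijection. -/
noncomputable def relabel {V : Finset α} {W : Finset β} (σ : V ≃ W) (g : Multigraph V) :
    Multigraph W where
  edges := g.edges.map (mapEdge σ)
  subset e he b hb := by
    obtain ⟨e, _, rfl⟩ := Multiset.mem_map.1 he
    obtain ⟨a, ha, _, rfl⟩ := (mem_mapEdge _ _ _).1 hb
    exact (σ ⟨a, ha⟩).2
  card_eq e he := by
    classical
    obtain ⟨e, heg, rfl⟩ := Multiset.mem_map.1 he
    rw [mapEdge, Finset.card_map, Finset.card_subtype]
    refine Eq.trans ?_ (g.card_eq e heg)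
    congr 1
    ext a
    rw [Finset.mem_filter]
    exact ⟨fun h => h.1, fun h => ⟨h, g.subset e heg h⟩⟩

theorem eq_of_empty (g g' : Multigraph (∅ : Finset α)) : g = g' := by
  have key : ∀ g : Multigraph (∅ : Finset α), g.edges = 0 := fun g =>
    Multiset.eq_zero_of_forall_notMem fun e he => by
      have h1 := g.card_eq e he
      rw [Finset.subset_empty.1 (g.subset e he)] at h1
      simp at h1
  ext1
  rw [key g, key g']

/-- The graph without edges. -/
def discrete (V : Finset α) : Multigraph V where
  edges := 0
  subset e he := absurd he (Multiset.notMem_zero e)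
  card_eq e he := absurd he (Multiset.notMem_zero e)

instance : Unique (Multigraph (∅ : Finset α)) where
  default := discrete ∅
  uniq g := eq_of_empty g _

theorem relabel_refl {V : Finset α} (g : Multigraph V) : relabel (Equiv.refl V) g = g := by
  ext1
  refine (Multiset.map_congr rfl fun e he => ?_).trans (Multiset.map_id _)
  ext a
  rw [mem_mapEdge]
  constructor
  · rintro ⟨b, _, hb, rfl⟩
    exact hb
  · intro ha
    exact ⟨a, g.subset e he ha, ha, rfl⟩

theorem relabel_trans {V : Finset α} {W : Finset β} {X : Finset γ} (σ : V ≃ W) (τ : W ≃ X)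
    (g : Multigraph V) : relabel (σ.trans τ) g = relabel τ (relabel σ g) := by
  ext1
  refine Eq.trans (Multiset.map_congr rfl fun e _ => ?_) (Multiset.map_map _ _ _).symm
  ext c
  simp only [mem_mapEdge, Function.comp]
  constructor
  · rintro ⟨a, ha, hae, rfl⟩
    exact ⟨σ ⟨a, ha⟩, (σ ⟨a, ha⟩).2, ⟨a, ha, hae, rfl⟩, rfl⟩
  · rintro ⟨b, hb, ⟨a, ha, hae, rfl⟩, rfl⟩
    exact ⟨a, ha, hae, rfl⟩

theorem mapEdge_congr {A V : Finset α} {A' V' : Finset β} (σ : V ≃ V') (σA : A ≃ A')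
    (hAV : ∀ a ∈ A, a ∈ V)
    (hσ : ∀ (a : α) (ha : a ∈ A) (hV : a ∈ V), (σ ⟨a, hV⟩ : β) = σA ⟨a, ha⟩)
    (e : Finset α) (he : e ⊆ A) : mapEdge σ e = mapEdge σA e := by
  ext b
  simp only [mem_mapEdge]
  constructor
  · rintro ⟨a, ha, hae, rfl⟩
    exact ⟨a, he hae, hae, (hσ a (he hae) ha).symm⟩
  · rintro ⟨a, ha, hae, rfl⟩
    exact ⟨a, hAV a ha, hae, hσ a ha (hAV a ha)⟩

theorem relabel_union {A B V : Finset α} {A' B' V' : Finset β}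
    (h : IsSplit A B V) (h' : IsSplit A' B' V') (σ : V ≃ V') (σA : A ≃ A') (σB : B ≃ B')
    (hA : ∀ (a : α) (ha : a ∈ A) (hV : a ∈ V), (σ ⟨a, hV⟩ : β) = σA ⟨a, ha⟩)
    (hB : ∀ (b : α) (hb : b ∈ B) (hV : b ∈ V), (σ ⟨b, hV⟩ : β) = σB ⟨b, hb⟩)
    (g₁ : Multigraph A) (g₂ : Multigraph B) :
    relabel σ (union h g₁ g₂) = union h' (relabel σA g₁) (relabel σB g₂) := by
  ext1
  simp only [relabel, union, Multiset.map_add]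
  congr 1
  · exact Multiset.map_congr rfl fun e he =>
      mapEdge_congr σ σA (fun a ha => (h.mem_iff a).2 (Or.inl ha)) hA e (g₁.subset e he)
  · exact Multiset.map_congr rfl fun e he =>
      mapEdge_congr σ σB (fun a ha => (h.mem_iff a).2 (Or.inr ha)) hB e (g₂.subset e he)

theorem restrict_relabel {A V : Finset α} {A' V' : Finset β} (σ : V ≃ V') (σA : A ≃ A')
    (hAV : ∀ a ∈ A, a ∈ V)
    (hσ : ∀ (a : α) (ha : a ∈ A) (hV : a ∈ V), (σ ⟨a, hV⟩ : β) = σA ⟨a, ha⟩)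
    (g : Multigraph V) : (relabel σ g).restrict A' = relabel σA (g.restrict A) := by
  classical
  ext1
  simp only [restrict, relabel]
  rw [Multiset.filter_map]
  have : g.edges.filter ((fun e => e ⊆ A') ∘ mapEdge σ) = g.edges.filter fun e => e ⊆ A := by
    refine Multiset.filter_congr fun e he => ?_
    constructor
    · intro hs a ha
      have haV := g.subset e he ha
      have hmem : (σ ⟨a, haV⟩ : β) ∈ A' := hs ((mem_mapEdge _ _ _).2 ⟨a, haV, ha, rfl⟩)
      obtain ⟨⟨a', ha'⟩, h'⟩ := σA.surjective ⟨_, hmem⟩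
      have h2 : (σ ⟨a', hAV a' ha'⟩ : β) = σ ⟨a, haV⟩ := by
        rw [hσ a' ha' (hAV a' ha'), h']
      have h3 := congrArg Subtype.val (σ.injective (Subtype.ext h2))
      simp only at h3
      exact h3 ▸ ha'
    · intro hs b hb
      obtain ⟨a, ha, hae, rfl⟩ := (mem_mapEdge _ _ _).1 hb
      rw [hσ a (hs hae) ha]
      exact (σA _).2
  rw [this]
  exact Multiset.map_congr rfl fun e he =>
    mapEdge_congr σ σA hAV hσ e (Multiset.mem_filter.1 he).2

theorem restrict_self {V : Finset α} (g : Multigraph V) : g.restrict V = g := by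
  classical
  ext1
  exact Multiset.filter_eq_self.2 g.subset

theorem restrict_restrict {A B V : Finset α} (hAB : A ⊆ B) (g : Multigraph V) :
    (g.restrict B).restrict A = g.restrict A := by
  classical
  ext1
  simp only [restrict, Multiset.filter_filter]
  exact Multiset.filter_congr fun e _ => ⟨fun h => h.1, fun h => ⟨h, h.trans hAB⟩⟩

theorem restrict_union {V V₁ V₂ V₃ V₁₃ V₂₃ : Finset α}
    (h₁₂ : IsSplit V₁ V₂ V) (h₁ : ∀ a, a ∈ V₁₃ ↔ a ∈ V₁ ∧ a ∈ V₃)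
    (h₂ : ∀ a, a ∈ V₂₃ ↔ a ∈ V₂ ∧ a ∈ V₃) (h₃ : IsSplit V₁₃ V₂₃ V₃)
    (g₁ : Multigraph V₁) (g₂ : Multigraph V₂) :
    (union h₁₂ g₁ g₂).restrict V₃ = union h₃ (g₁.restrict V₁₃) (g₂.restrict V₂₃) := by
  classical
  ext1
  simp only [restrict, union, Multiset.filter_add]
  congr 1
  · refine Multiset.filter_congr fun e he => ⟨fun h a ha => ?_, fun h a ha => ?_⟩
    · exact (h₁ a).2 ⟨g₁.subset e he ha, h ha⟩
    · exact ((h₁ a).1 (h ha)).2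
  · refine Multiset.filter_congr fun e he => ⟨fun h a ha => ?_, fun h a ha => ?_⟩
    · exact (h₂ a).2 ⟨g₂.subset e he ha, h ha⟩
    · exact ((h₂ a).1 (h ha)).2

theorem union_discrete {V : Finset α} (h : IsSplit V ∅ V) (g : Multigraph V) :
    union h g (discrete ∅) = g := by
  ext1
  exact add_zero _

theorem discrete_union {V : Finset α} (h : IsSplit ∅ V V) (g : Multigraph V) :
    union h (discrete ∅) g = g := by
  ext1
  exact zero_add _

theorem union_assoc {A B C AB BC V : Finset α} (hAB : IsSplit A B AB)
    (hABC : IsSplit AB C V) (hBC : IsSplit B C BC) (hABC' : IsSplit A BC V)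
    (g₁ : Multigraph A) (g₂ : Multigraph B) (g₃ : Multigraph C) :
    union hABC' g₁ (union hBC g₂ g₃) = union hABC (union hAB g₁ g₂) g₃ := by
  ext1
  exact (add_assoc _ _ _).symm

/-- The product `g₁ ⊗ g₂ ↦ g₁ ⊔ g₂`, extended linearly. -/
noncomputable def linMul (K : Type w) [Field K] {A B V : Finset α} (h : IsSplit A B V) :
    (Multigraph A →₀ K) ⊗[K] (Multigraph B →₀ K) →ₗ[K] (Multigraph V →₀ K) :=
  TensorProduct.lift <|
    Finsupp.lift _ K _ fun g₁ => Finsupp.lift _ K _ fun g₂ => Finsupp.single (union h g₁ g₂) 1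

/-- The coproduct `g ↦ g|_A ⊗ g|_B`, extended linearly. -/
noncomputable def linComul (K : Type w) [Field K] {A B V : Finset α} (_h : IsSplit A B V) :
    (Multigraph V →₀ K) →ₗ[K] (Multigraph A →₀ K) ⊗[K] (Multigraph B →₀ K) :=
  Finsupp.lift _ K _ fun g => Finsupp.single (g.restrict A) 1 ⊗ₜ Finsupp.single (g.restrict B) 1

theorem linMul_single (K : Type w) [Field K] {A B V : Finset α} (h : IsSplit A B V)
    (g₁ : Multigraph A) (g₂ : Multigraph B) :
    linMul K h (Finsupp.single g₁ 1 ⊗ₜ Finsupp.single g₂ 1) = Finsupp.single (union h g₁ g₂) 1 := by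
  simp [linMul]

theorem linMul_single' (K : Type w) [Field K] {A B V : Finset α} (h : IsSplit A B V)
    (g₁ : Multigraph A) (g₂ : Multigraph B) (a b : K) :
    linMul K h (Finsupp.single g₁ a ⊗ₜ Finsupp.single g₂ b)
      = Finsupp.single (union h g₁ g₂) (a * b) := by
  simp [linMul]

theorem linComul_single (K : Type w) [Field K] {A B V : Finset α} (h : IsSplit A B V)
    (g : Multigraph V) :
    linComul K h (Finsupp.single g 1)
      = Finsupp.single (g.restrict A) 1 ⊗ₜ Finsupp.single (g.restrict B) 1 := by
  simp [linComul]

end Multigraph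

theorem IsSplit.left {α : Type u} {A B V : Finset α} (h : IsSplit A B V) : A ⊆ V :=
  fun a ha => (h.mem_iff a).2 (Or.inl ha)

theorem IsSplit.right {α : Type u} {A B V : Finset α} (h : IsSplit A B V) : B ⊆ V :=
  fun a ha => (h.mem_iff a).2 (Or.inr ha)

namespace Multigraph

theorem linMul_assoc (K : Type w) [Field K] {α : Type u} {A B C AB BC V : Finset α}
    (hAB : IsSplit A B AB) (hABC : IsSplit AB C V) (hBC : IsSplit B C BC)
    (hABC' : IsSplit A BC V) (x : Multigraph A →₀ K) (y : Multigraph B →₀ K)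
    (z : Multigraph C →₀ K) :
    linMul K hABC' (x ⊗ₜ linMul K hBC (y ⊗ₜ z)) = linMul K hABC (linMul K hAB (x ⊗ₜ y) ⊗ₜ z) := by
  induction x using Finsupp.induction_linear with
  | zero => simp
  | add x x' hx hx' => simp only [TensorProduct.add_tmul, map_add, hx, hx']
  | single g₁ a =>
    induction y using Finsupp.induction_linear with
    | zero => simp
    | add y y' hy hy' =>
      simp only [TensorProduct.add_tmul, TensorProduct.tmul_add, map_add, hy, hy']
    | single g₂ b =>
      induction z using Finsupp.induction_linear with
      | zero => simp
      | add z z' hz hz' => simp only [TensorProduct.tmul_add, map_add, hz, hz']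
      | single g₃ c =>
        simp only [linMul_single', union_assoc hAB hABC hBC hABC', mul_assoc]

theorem linComul_coassoc (K : Type w) [Field K] {α : Type u} {A B C AB BC V : Finset α}
    (hAB : IsSplit A B AB) (hABC : IsSplit AB C V) (hBC : IsSplit B C BC)
    (hABC' : IsSplit A BC V) :
    (TensorProduct.assoc K (Multigraph A →₀ K) (Multigraph B →₀ K)
        (Multigraph C →₀ K)).toLinearMap ∘ₗ
        TensorProduct.map (linComul K hAB) LinearMap.id ∘ₗ linComul K hABC
      = TensorProduct.map LinearMap.id (linComul K hBC) ∘ₗ linComul K hABC' := by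
  refine Finsupp.lhom_ext' fun g => LinearMap.ext_ring ?_
  simp [linComul_single, restrict_restrict hAB.left, restrict_restrict hAB.right,
    restrict_restrict hBC.left, restrict_restrict hBC.right]

theorem linMul_linComul (K : Type w) [Field K] {α : Type u}
    {V V₁ V₂ V₃ V₄ V₁₃ V₁₄ V₂₃ V₂₄ : Finset α}
    (h₁₂ : IsSplit V₁ V₂ V) (h₃₄ : IsSplit V₃ V₄ V) (h₁ : IsSplit V₁₃ V₁₄ V₁)
    (h₂ : IsSplit V₂₃ V₂₄ V₂) (h₃ : IsSplit V₁₃ V₂₃ V₃) (h₄ : IsSplit V₁₄ V₂₄ V₄) :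
    linComul K h₃₄ ∘ₗ linMul K h₁₂
      = TensorProduct.map (linMul K h₃) (linMul K h₄) ∘ₗ
        (TensorProduct.tensorTensorTensorComm K (Multigraph V₁₃ →₀ K) (Multigraph V₁₄ →₀ K)
          (Multigraph V₂₃ →₀ K) (Multigraph V₂₄ →₀ K)).toLinearMap ∘ₗ
        TensorProduct.map (linComul K h₁) (linComul K h₂) := by
  have key : ∀ a, (a ∈ V₁₃ ↔ a ∈ V₁ ∧ a ∈ V₃) ∧ (a ∈ V₂₃ ↔ a ∈ V₂ ∧ a ∈ V₃) ∧
      (a ∈ V₁₄ ↔ a ∈ V₁ ∧ a ∈ V₄) ∧ (a ∈ V₂₄ ↔ a ∈ V₂ ∧ a ∈ V₄) := by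
    intro a
    have e1 := h₁.mem_iff a
    have e2 := h₂.mem_iff a
    have e3 := h₃.mem_iff a
    have e4 := h₄.mem_iff a
    have d1 : a ∈ V₁ → a ∉ V₂ := fun h => Finset.disjoint_left.1 h₁₂.disj h
    have d2 : a ∈ V₃ → a ∉ V₄ := fun h => Finset.disjoint_left.1 h₃₄.disj h
    grind
  have r₃ := fun g₁ g₂ =>
    restrict_union h₁₂ (fun a => (key a).1) (fun a => (key a).2.1) h₃ g₁ g₂
  have r₄ := fun g₁ g₂ =>
    restrict_union h₁₂ (fun a => (key a).2.2.1) (fun a => (key a).2.2.2) h₄ g₁ g₂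
  apply TensorProduct.ext
  refine Finsupp.lhom_ext' fun g₁ => LinearMap.ext_ring ?_
  refine Finsupp.lhom_ext' fun g₂ => LinearMap.ext_ring ?_
  simp [linMul_single, linComul_single, r₃, r₄]

end Multigraph

open Multigraph in
/-- The Hopf monoid `G` of graphs over `K`: `G[V]` has the graphs over `V` as a basis, the product
is the disjoint union and the coproduct is `g ↦ g|_{V₁} ⊗ g|_{V₂}`. -/
noncomputable def graphMonoid (K : Type w) [Field K] : HopfMonoid.{u, max u w, w} K where
  obj V := Multigraph V →₀ K
  addCommGroup _ := inferInstance
  module _ := inferInstance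
  map σ := Finsupp.lmapDomain K K (relabel σ)
  map_refl V := by
    refine Finsupp.lhom_ext' fun g => LinearMap.ext_ring ?_
    simp [relabel_refl]
  map_trans σ τ := by
    refine Finsupp.lhom_ext' fun g => LinearMap.ext_ring ?_
    simp [relabel_trans]
  unit α := (Finsupp.uniqueLinearEquiv K K (discrete (∅ : Finset α))).symm
  map_unit σ r := by
    simp only [Finsupp.uniqueLinearEquiv_symm_apply, Finsupp.lmapDomain_apply,
      Finsupp.mapDomain_single]
    rw [Subsingleton.elim (relabel σ (discrete ∅)) (discrete ∅)]
  mul h := linMul K h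
  comul h := linComul K h
  map_mul h h' σ σA σB hA hB := by
    refine TensorProduct.ext ?_
    refine Finsupp.lhom_ext' fun g₁ => LinearMap.ext_ring ?_
    refine Finsupp.lhom_ext' fun g₂ => LinearMap.ext_ring ?_
    simp [linMul_single, relabel_union h h' σ σA σB hA hB]
  map_comul h h' σ σA σB hA hB := by
    refine Finsupp.lhom_ext' fun g => LinearMap.ext_ring ?_
    simp [linComul_single, restrict_relabel σ σA h.left hA, restrict_relabel σ σB h.right hB]
  mul_unit h x := by
    have key : linMul K h ∘ₗ (TensorProduct.mk K _ _).flip (Finsupp.single (discrete ∅) 1)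
        = LinearMap.id := by
      refine Finsupp.lhom_ext' fun g => LinearMap.ext_ring ?_
      simp [linMul_single, union_discrete]
    simpa using LinearMap.congr_fun key x
  unit_mul h x := by
    have key : linMul K h ∘ₗ TensorProduct.mk K _ _ (Finsupp.single (discrete ∅) 1)
        = LinearMap.id := by
      refine Finsupp.lhom_ext' fun g => LinearMap.ext_ring ?_
      simp [linMul_single, discrete_union]
    simpa using LinearMap.congr_fun key x
  comul_unit h x := by
    have key : linComul K h = (TensorProduct.mk K _ _).flip (Finsupp.single (discrete ∅) 1) := by
      refine Finsupp.lhom_ext' fun g => LinearMap.ext_ring ?_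
      simp [linComul_single, restrict_self, eq_of_empty _ (discrete ∅)]
    simpa using LinearMap.congr_fun key x
  unit_comul h x := by
    have key : linComul K h = TensorProduct.mk K _ _ (Finsupp.single (discrete ∅) 1) := by
      refine Finsupp.lhom_ext' fun g => LinearMap.ext_ring ?_
      simp [linComul_single, restrict_self, eq_of_empty _ (discrete ∅)]
    simpa using LinearMap.congr_fun key x
  mul_assoc := linMul_assoc K
  comul_assoc := linComul_coassoc K
  compat := linMul_linComul K

/-- A graph as a basis element of `G[V]`. -/
noncomputable def Multigraph.toG (K : Type w) [Field K] {α : Type u} {V : Finset α}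
    (g : Multigraph V) : (graphMonoid.{u, w} K).obj V :=
  (Finsupp.single g 1 : Multigraph V →₀ K)

theorem graphMonoid_mul_toG (K : Type w) [Field K] {α : Type u} {A B V : Finset α}
    (h : IsSplit A B V) (g₁ : Multigraph A) (g₂ : Multigraph B) :
    (graphMonoid K).mul h (g₁.toG K ⊗ₜ g₂.toG K) = (Multigraph.union h g₁ g₂).toG K :=
  Multigraph.linMul_single K h g₁ g₂

theorem graphMonoid_comul_toG (K : Type w) [Field K] {α : Type u} {A B V : Finset α}
    (h : IsSplit A B V) (g : Multigraph V) :
    (graphMonoid K).comul h (g.toG K) = (g.restrict A).toG K ⊗ₜ (g.restrict B).toG K :=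
  Multigraph.linComul_single K h g

/-- A character of `G` is a characteristic function if it is `0` or `1` on every graph. -/
def IsCharacteristic {K : Type w} [Field K] (ζ : (graphMonoid.{u, w} K).Character) : Prop :=
  ∀ {α : Type u} {V : Finset α} (g : Multigraph V),
    ζ.toFun V (g.toG K) = 0 ∨ ζ.toFun V (g.toG K) = 1

namespace Multigraph

variable {α : Type u} {V : Finset α}

/-! ## Connected components -/

/-- The underlying simple graph. -/
def toSimple (g : Multigraph V) : SimpleGraph V where
  Adj x y := x ≠ y ∧ ∃ e ∈ g.edges, (x : α) ∈ e ∧ (y : α) ∈ e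
  symm := ⟨fun _ _ h => ⟨h.1.symm, h.2.imp fun _ h => ⟨h.1, h.2.2, h.2.1⟩⟩⟩
  loopless := ⟨fun _ h => h.1 rfl⟩

/-- Connected graphs (in particular with at least one vertex). -/
def Connected (g : Multigraph V) : Prop := g.toSimple.Connected

/-- The connected components; every isolated vertex is one. -/
abbrev Component (g : Multigraph V) : Type u := g.toSimple.ConnectedComponent

/-- The number of connected components. -/
noncomputable def cc (g : Multigraph V) : ℕ := Nat.card g.Component

/-! ## Partial orientations -/

open scoped Classical in
/-- The edges of `g`, each with its multiplicity: an element is an edge together with the number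
of one of its copies. -/
abbrev Edge (g : Multigraph V) : Type u := g.edges.ToType

/-- The set of the two ends of an edge. -/
def ends (g : Multigraph V) (e : g.Edge) : Set V := {v | (v : α) ∈ e.1}

/-- A partial orientation of `g`: some of the edges are sent on one of their ends, and the others
(value `none`) are not oriented. -/
abbrev PartialOrientation (g : Multigraph V) : Type u :=
  {f : g.Edge → Option V // ∀ e v, f e = some v → v ∈ g.ends e}

open scoped Classical in
noncomputable instance (g : Multigraph V) : Fintype g.PartialOrientation :=
  inferInstance

end Multigraph

namespace Multigraph.PartialOrientation

variable {α : Type u} {V : Finset α} {g : Multigraph V}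

/-- All edges are oriented. -/
def IsDiscrete (f : g.PartialOrientation) : Prop := ∀ e, f.1 e ≠ none

/-- The admissible orientation `κ_f`: `κ_f(e) = f(e)` if `e` is oriented and `κ_f(e) = e` if not. -/
def kappa (f : g.PartialOrientation) (e : g.Edge) : Set V :=
  match f.1 e with
  | none => g.ends e
  | some v => {v}

/-- The source `e ∖ κ_f(e)`. -/
def source (f : g.PartialOrientation) (e : g.Edge) : Set V := g.ends e \ kappa f e

/-- There is no sequence of distinct edges `e₀, …, e_k` with
`κ_f(eᵢ) ∩ source(eᵢ₊₁) ≠ ∅` or `∅ ⊊ κ_f(eᵢ) ∩ eᵢ₊₁ ⊊ κ_f(eᵢ₊₁)` for all `i < k` and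
`κ_f(e_k) ∩ source(e₀) ≠ ∅`. -/
def IsAcyclic (f : g.PartialOrientation) : Prop :=
  ¬ ∃ (k : ℕ) (e : Fin (k + 1) → g.Edge), Function.Injective e ∧
    (∀ i : Fin k,
      (kappa f (e i.castSucc) ∩ source f (e i.succ)).Nonempty ∨
      ((kappa f (e i.castSucc) ∩ g.ends (e i.succ)).Nonempty ∧
        kappa f (e i.castSucc) ∩ g.ends (e i.succ) ⊂ kappa f (e i.succ))) ∧
    (kappa f (e (Fin.last k)) ∩ source f (e 0)).Nonempty

open scoped Classical in
/-- The graph `f(g)` over `V` formed by the edges that are not oriented. -/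
noncomputable def image (f : g.PartialOrientation) : Multigraph V where
  edges := ((Finset.univ : Finset g.Edge).filter fun e => f.1 e = none).val.map fun e => e.1
  subset e he := by
    obtain ⟨e, _, rfl⟩ := Multiset.mem_map.1 he
    exact g.subset _ Multiset.coe_mem
  card_eq e he := by
    obtain ⟨e, _, rfl⟩ := Multiset.mem_map.1 he
    exact g.card_eq _ Multiset.coe_mem

/-- `max_c(e)`: the vertices of `e` of maximal color. -/
def maxVertices (g : Multigraph V) {n : ℕ} (c : V → Fin n) (e : g.Edge) : Set V :=
  {v | v ∈ g.ends e ∧ ∀ w ∈ g.ends e, c w ≤ c v}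

/-- `c` is strictly compatible with `f`: `f(e) = max_c(e)` for the oriented edges, and the other
edges are monochromatic. -/
def IsStrictlyCompatible (f : g.PartialOrientation) {n : ℕ} (c : V → Fin n) : Prop :=
  ∀ e, (∀ v, f.1 e = some v → {v} = maxVertices g c e) ∧
    (f.1 e = none → maxVertices g c e = g.ends e)

/-- `c` is compatible with `f`: `f(e) ∈ max_c(e)` for the oriented edges, and the other edges are
monochromatic. -/
def IsCompatible (f : g.PartialOrientation) {n : ℕ} (c : V → Fin n) : Prop :=
  ∀ e, (∀ v, f.1 e = some v → v ∈ maxVertices g c e) ∧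
    (f.1 e = none → maxVertices g c e = g.ends e)

/-- The colorings of `V` with `n` colors strictly compatible with `f`. -/
abbrev StrictColoring (f : g.PartialOrientation) (n : ℕ) : Type u :=
  {c : V → Fin n // IsStrictlyCompatible f c}

/-- The colorings of `V` with `n` colors compatible with `f`. -/
abbrev Coloring (f : g.PartialOrientation) (n : ℕ) : Type u :=
  {c : V → Fin n // IsCompatible f c}

end Multigraph.PartialOrientation

namespace Multigraph

variable {α : Type u} {V : Finset α}

/-- Acyclic partial orientations of `g`. -/
abbrev AcyclicOrientation (g : Multigraph V) : Type u :=
  {f : g.PartialOrientation // f.IsAcyclic}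

/-- Acyclic orientations of `g` in which every edge is oriented. -/
abbrev DiscreteAcyclicOrientation (g : Multigraph V) : Type u :=
  {f : g.PartialOrientation // f.IsDiscrete ∧ f.IsAcyclic}

open scoped Classical in
noncomputable instance (g : Multigraph V) : Fintype g.AcyclicOrientation := inferInstance

open scoped Classical in
noncomputable instance (g : Multigraph V) : Fintype g.DiscreteAcyclicOrientation := inferInstance

/-! ## Flats and quotients -/

/-- `F = g|_{D₁} ⊔ ⋯ ⊔ g|_{Dₙ}` for a composition `D` of `V`. -/
def IsFlat (g F : Multigraph V) : Prop :=
  ∃ (n : ℕ) (D : Decomposition V n), D.IsComposition ∧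
    F.edges = ∑ i, (g.restrict (D.parts i)).edges

/-- The flats of `g`. -/
abbrev Flat (g : Multigraph V) : Type u := {F : Multigraph V // g.IsFlat F}

theorem IsFlat.exists_mem_parts {g F : Multigraph V} {n : ℕ} {D : Decomposition V n}
    (h : F.edges = ∑ i, (g.restrict (D.parts i)).edges) {e : Finset α} (he : e ∈ F.edges) :
    e ∈ g.edges ∧ ∃ i, e ⊆ D.parts i := by
  classical
  rw [h, Multiset.mem_sum] at he
  obtain ⟨i, _, hi⟩ := he
  have := Multiset.mem_filter.1 hi
  exact ⟨this.1, i, this.2⟩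

open scoped Classical in
theorem IsFlat.not_subset_parts {g F : Multigraph V} {n : ℕ} {D : Decomposition V n}
    (h : F.edges = ∑ i, (g.restrict (D.parts i)).edges) {e : Finset α}
    (he : e ∈ g.edges - F.edges) (i : Fin n) : ¬ e ⊆ D.parts i := by
  intro hi
  have h1 : (g.restrict (D.parts i)).edges ≤ F.edges := by
    rw [h]
    exact Finset.single_le_sum (f := fun i => (g.restrict (D.parts i)).edges)
      (fun _ _ => Multiset.zero_le _) (Finset.mem_univ i)
  have h2 := Multiset.count_le_of_le e h1
  have h3 : (g.restrict (D.parts i)).edges.count e = g.edges.count e :=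
    Multiset.count_filter_of_pos (p := fun e => e ⊆ D.parts i) hi
  have h4 := Multiset.count_pos.2 he
  rw [Multiset.count_sub] at h4
  omega

theorem IsFlat.reachable {g F : Multigraph V} {n : ℕ} {D : Decomposition V n}
    (h : F.edges = ∑ i, (g.restrict (D.parts i)).edges) {x y : V}
    (hxy : F.toSimple.Reachable x y) (i : Fin n) (hx : (x : α) ∈ D.parts i) :
    (y : α) ∈ D.parts i := by
  obtain ⟨p⟩ := hxy
  induction p with
  | nil => exact hx
  | cons hadj _ ih =>
    obtain ⟨_, e, he, hxe, hye⟩ := hadj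
    obtain ⟨_, j, hj⟩ := IsFlat.exists_mem_parts h he
    have hij : i = j := by
      by_contra hne
      exact Finset.disjoint_left.1 (D.disj i j hne) hx (hj hxe)
    exact ih (hij ▸ hj hye)

noncomputable instance (g : Multigraph V) : Fintype g.Flat := by
  classical
  refine @Fintype.ofFinite _ (Finite.of_injective
    (fun F : g.Flat => (⟨F.1.edges, ?_⟩ : {s // s ∈ g.edges.powerset.toFinset})) ?_)
  · obtain ⟨F, n, D, _, h⟩ := F
    rw [Multiset.mem_toFinset, Multiset.mem_powerset, Multiset.le_iff_count]
    intro e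
    by_cases he : e ∈ F.edges
    · by_contra hlt
      obtain ⟨heg, i, hi⟩ := IsFlat.exists_mem_parts h he
      have hne : e.Nonempty := Finset.card_pos.1 (by rw [g.card_eq e heg]; norm_num)
      obtain ⟨a, ha⟩ := hne
      rw [h, Multiset.count_sum', Finset.sum_eq_single i] at hlt
      · exact hlt (Multiset.count_le_of_le e (Multiset.filter_le _ _))
      · intro j _ hji
        refine Multiset.count_eq_zero_of_notMem fun hj => ?_
        exact Finset.disjoint_left.1 (D.disj j i hji) ((Multiset.mem_filter.1 hj).2 ha) (hi ha)
      · exact fun hn => absurd (Finset.mem_univ i) hn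
    · simp [Multiset.count_eq_zero_of_notMem he]
  · intro F F' h
    exact Subtype.ext (Multigraph.ext (congrArg Subtype.val h))

/-- The vertex set of `g/F`: the connected components of `F`. -/
noncomputable def quotientVertices (F : Multigraph V) : Finset F.Component :=
  @Finset.univ _ (Fintype.ofFinite _)

open scoped Classical in
/-- The image of an edge in the quotient by `F`. -/
noncomputable def quotientEdge (F : Multigraph V) (e : Finset α) : Finset F.Component :=
  (e.subtype (· ∈ V)).image F.toSimple.connectedComponentMk

open scoped Classical in
/-- The quotient `g/F` of `g` by a flat `F`: delete the edges of `F` and merge the vertices that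
share a connected component of `F`. -/
noncomputable def quotient (g : Multigraph V) (F : g.Flat) :
    Multigraph (quotientVertices F.1) where
  edges := (g.edges - F.1.edges).map (quotientEdge F.1)
  subset _ _ _ _ := @Finset.mem_univ _ (Fintype.ofFinite _) _
  card_eq e' he' := by
    obtain ⟨F, n, D, _, h⟩ := F
    obtain ⟨e, he, rfl⟩ := Multiset.mem_map.1 he'
    have heg : e ∈ g.edges := Multiset.mem_of_le (Multiset.sub_le_self _ _) he
    have hcard : (e.subtype (· ∈ V)).card = 2 := by
      rw [Finset.card_subtype]
      refine Eq.trans ?_ (g.card_eq e heg)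
      congr 1
      ext a
      rw [Finset.mem_filter]
      exact ⟨fun h => h.1, fun h => ⟨h, g.subset e heg h⟩⟩
    rw [quotientEdge, Finset.card_image_of_injOn, hcard]
    intro x hx y hy hxy
    by_contra hne
    have hreach := SimpleGraph.ConnectedComponent.eq.1 hxy
    obtain ⟨i, hi⟩ := (D.mem_iff x).1 x.2
    have hyi := IsFlat.reachable h hreach i hi
    refine IsFlat.not_subset_parts h he i fun a ha => ?_
    have hx' : (x : α) ∈ e := by simpa using hx
    have hy' : (y : α) ∈ e := by simpa using hy
    obtain ⟨b, c, _, rfl⟩ := Finset.card_eq_two.1 (g.card_eq e heg)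
    have hne' : (x : α) ≠ y := fun h => hne (Subtype.ext h)
    simp only [Finset.mem_insert, Finset.mem_singleton] at hx' hy' ha
    rcases ha with rfl | rfl <;> rcases hx' with h1 | h1 <;> rcases hy' with h2 | h2 <;>
      first
        | (exact absurd (h1.trans h2.symm) hne')
        | (rw [← h1]; exact hi)
        | (rw [← h2]; exact hyi)

end Multigraph

/-- An odd character of `G`: the connected graphs on which it does not vanish have an odd number
of vertices. -/
def IsOdd {K : Type w} [Field K] (ζ : (graphMonoid.{u, w} K).Character) : Prop :=
  ∀ {α : Type u} {V : Finset α} (g : Multigraph V),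
    g.Connected → ζ.toFun V (g.toG K) ≠ 0 → Odd V.card

end GraphHopf

/-! The coproduct cuts a graph along the classes of a coloring and the product glues the pieces
together again, so the invariant at `n` is the sum, over all colorings `V → Fin n`, of `ζ` of the
monochromatic subgraph (`chi_toG`).

Each coloring is strictly compatible with exactly one partial orientation: an edge points to its end
of larger color and stays unoriented if the colors agree. It is acyclic, because colors never
decrease along a directed path and increase on oriented edges, and its unoriented edges form the
monochromatic subgraph. Grouping colorings by this orientation gives the sum over acyclic
orientations (`sum_acyclicOrientation`). The monochromatic subgraph is also a flat `F`, and the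
colorings with this subgraph are the proper colorings of `g/F`; grouping those by discrete acyclic
orientations gives the sum over flats (`sum_flat`).

For negative arguments, fix an acyclic `f`. Compatible colorings are constant on the components of
`f(g)`, and the oriented edges induce a relation without cycles on these components. Strict and weak
colorings thus become strictly and weakly increasing maps for this relation, and Stanley's
reciprocity (`OrderPolynomial.exists_polynomial`) gives a polynomial and the sign `(-1) ^ cc`. The
polynomials built from the two sums agree on `ℕ`, hence everywhere. If `ζ` is odd and does not
vanish on `f(g)`, every component of `f(g)` has an odd number of vertices, so `|V|` and `cc` have
the same parity and the signs cancel (`neg_one_pow_cc`). -/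

namespace OrderPolynomial

/-! ### Order polynomials and their reciprocity -/

open Finset Polynomial

section

variable {W : Type*} [Fintype W] [DecidableEq W]

open scoped Classical in
/-- The maps from `S` to `{0, …, n - 1}`, extended by zero, such that `r (c x) (c y)` whenever
`R x y`. -/
noncomputable def maps (r : ℕ → ℕ → Prop) (R : W → W → Prop) (S : Finset W) (n : ℕ) :
    Finset (W → ℕ) :=
  (Fintype.piFinset fun x => if x ∈ S then range n else {0}).filter
    fun c => ∀ x ∈ S, ∀ y ∈ S, R x y → r (c x) (c y)

theorem mem_maps {r : ℕ → ℕ → Prop} {R : W → W → Prop} {S : Finset W} {n : ℕ} {c : W → ℕ} :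
    c ∈ maps r R S n ↔ (∀ x ∈ S, c x < n) ∧ (∀ x ∉ S, c x = 0) ∧
      ∀ x ∈ S, ∀ y ∈ S, R x y → r (c x) (c y) := by
  classical
  rw [maps, mem_filter, Fintype.mem_piFinset]
  constructor
  · rintro ⟨h, h'⟩
    refine ⟨fun x hx => ?_, fun x hx => ?_, h'⟩
    · simpa [hx] using h x
    · simpa [hx] using h x
  · rintro ⟨h1, h2, h3⟩
    refine ⟨fun x => ?_, h3⟩
    by_cases hx : x ∈ S
    · simpa [hx] using h1 x hx
    · simpa [hx] using h2 x hx

open scoped Classical in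
/-- The maximal elements of `S`. -/
noncomputable def maxes (R : W → W → Prop) (S : Finset W) : Finset W :=
  S.filter fun x => ∀ y ∈ S, ¬ R x y

theorem mem_maxes {R : W → W → Prop} {S : Finset W} {x : W} :
    x ∈ maxes R S ↔ x ∈ S ∧ ∀ y ∈ S, ¬ R x y := by
  classical
  simp [maxes]

/-- If `A` is exactly the class of the top color `n`, the other elements use colors below `n`.
Conversely `A` can be given color `n` freely, since nothing lies above its elements. Off the domain
the color is `0` by convention. -/
theorem card_strict_fiber {R : W → W → Prop} {S A : Finset W} (hA : A ⊆ maxes R S) (n : ℕ) :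
    ((maps (· < ·) R S (n + 1)).filter fun c => S.filter (fun x => c x = n) = A).card
      = (maps (· < ·) R (S \ A) n).card := by
  have hA' : ∀ x ∈ A, x ∈ S ∧ ∀ y ∈ S, ¬ R x y := fun x hx => mem_maxes.1 (hA hx)
  refine card_bij' (fun c _ x => if x ∈ A then 0 else c x)
    (fun c _ x => if x ∈ A then n else c x) ?_ ?_ ?_ ?_
  · intro c hc
    obtain ⟨hc', hcA⟩ := mem_filter.1 hc
    have hcA' : ∀ x, x ∈ A ↔ x ∈ S ∧ c x = n := by simp [← hcA]
    obtain ⟨h1, h2, h3⟩ := mem_maps.1 hc'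
    refine mem_maps.2 ⟨fun x hx => ?_, fun x hx => ?_, fun x hx y hy hxy => ?_⟩
    · have := h1 x; grind
    · have := h2 x; grind
    · have := h3 x; grind
  · intro c hc
    obtain ⟨h1, h2, h3⟩ := mem_maps.1 hc
    refine mem_filter.2 ⟨mem_maps.2 ⟨fun x hx => ?_, fun x hx => ?_, fun x hx y hy hxy => ?_⟩, ?_⟩
    · have := h1 x; grind
    · have := h2 x; grind
    · have := h3 x; have := h1 x; have := hA' x; grind
    · ext x
      have := h1 x; have := hA' x; grind
  · intro c hc
    obtain ⟨hc', hcA⟩ := mem_filter.1 hc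
    have hcA' : ∀ x, x ∈ A ↔ x ∈ S ∧ c x = n := by simp [← hcA]
    funext x
    grind
  · intro c hc
    obtain ⟨h1, h2, h3⟩ := mem_maps.1 hc
    funext x
    have := h2 x; grind

/-- Maps are sorted by their class of color `n`; strictness forces that class to consist of maximal
elements. -/
theorem card_strict_succ (R : W → W → Prop) (S : Finset W) (n : ℕ) :
    (maps (· < ·) R S (n + 1)).card
      = ∑ A ∈ (maxes R S).powerset, (maps (· < ·) R (S \ A) n).card := by
  rw [card_eq_sum_card_fiberwise (f := fun c : W → ℕ => S.filter (fun x => c x = n))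
    (t := (maxes R S).powerset)]
  · exact sum_congr rfl fun A hA => card_strict_fiber (mem_powerset.1 hA) n
  · intro c hc
    obtain ⟨h1, h2, h3⟩ := mem_maps.1 hc
    refine mem_coe.2 (mem_powerset.2 fun x hx => ?_)
    obtain ⟨hx, hxn⟩ := mem_filter.1 hx
    refine mem_maxes.2 ⟨hx, fun y hy hxy => ?_⟩
    have := h3 x hx y hy hxy
    have := h1 y hy
    omega

/-- Same deletion as in the strict case, but elements outside `A` may also have color `n`, so the
number of colors does not drop. -/
theorem card_weak_top {R : W → W → Prop} {S A : Finset W} (hA : A ⊆ maxes R S) (n : ℕ) :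
    ((maps (· ≤ ·) R S (n + 1)).filter fun c => ∀ x ∈ A, c x = n).card
      = (maps (· ≤ ·) R (S \ A) (n + 1)).card := by
  have hA' : ∀ x ∈ A, x ∈ S ∧ ∀ y ∈ S, ¬ R x y := fun x hx => mem_maxes.1 (hA hx)
  refine card_bij' (fun c _ x => if x ∈ A then 0 else c x)
    (fun c _ x => if x ∈ A then n else c x) ?_ ?_ ?_ ?_
  · intro c hc
    obtain ⟨hc, hcA⟩ := mem_filter.1 hc
    obtain ⟨h1, h2, h3⟩ := mem_maps.1 hc
    refine mem_maps.2 ⟨fun x hx => ?_, fun x hx => ?_, fun x hx y hy hxy => ?_⟩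
    · have := h1 x; grind
    · have := h2 x; grind
    · have := h3 x; grind
  · intro c hc
    obtain ⟨h1, h2, h3⟩ := mem_maps.1 hc
    refine mem_filter.2 ⟨mem_maps.2 ⟨fun x hx => ?_, fun x hx => ?_, fun x hx y hy hxy => ?_⟩, ?_⟩
    · have := h1 x; grind
    · have := h2 x; grind
    · have := h3 x; have := h1 x; have := hA' x; grind
    · intro x hx
      simp [hx]
  · intro c hc
    obtain ⟨hc, hcA⟩ := mem_filter.1 hc
    funext x
    grind
  · intro c hc
    obtain ⟨h1, h2, h3⟩ := mem_maps.1 hc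
    funext x
    have := h2 x; grind

/-- Climbing from any element ends at a maximal one, and colors do not decrease on the way. So color
`n` is avoided everywhere once it is avoided on the maximal elements. -/
theorem filter_weak_eq {R : W → W → Prop} (hR : WellFounded (flip R)) (S : Finset W) (n : ℕ) :
    ((maps (· ≤ ·) R S (n + 1)).filter fun c => (maxes R S).filter (fun x => c x = n) = ∅)
      = maps (· ≤ ·) R S n := by
  ext c
  rw [mem_filter, mem_maps, mem_maps]
  constructor
  · rintro ⟨⟨h1, h2, h3⟩, h⟩
    refine ⟨fun x => ?_, h2, h3⟩
    induction x using hR.induction with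
    | _ x ih =>
      intro hx
      by_cases hm : x ∈ maxes R S
      · have h4 : c x ≠ n := fun hxn => by
          have : x ∈ (maxes R S).filter (fun x => c x = n) := mem_filter.2 ⟨hm, hxn⟩
          rw [h] at this
          exact notMem_empty _ this
        have := h1 x hx
        omega
      · have h4 : ∃ y ∈ S, R x y := by
          by_contra! h4
          exact hm (mem_maxes.2 ⟨hx, h4⟩)
        obtain ⟨y, hy, hxy⟩ := h4
        exact (h3 x hx y hy hxy).trans_lt (ih y hxy hy)
  · rintro ⟨h1, h2, h3⟩
    refine ⟨⟨fun x hx => (h1 x hx).trans n.lt_succ_self, h2, h3⟩, ?_⟩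
    refine filter_eq_empty_iff.2 fun x hx => ?_
    exact (h1 x (mem_maxes.1 hx).1).ne

/-- Inclusion–exclusion over the set of maximal elements of color `n`. This is the recursion that
matches the strict one at negative arguments. -/
theorem card_weak_eq_sum {R : W → W → Prop} (hR : WellFounded (flip R)) (S : Finset W) (n : ℕ) :
    ((maps (· ≤ ·) R S n).card : ℚ)
      = ∑ A ∈ (maxes R S).powerset, (-1) ^ A.card * ((maps (· ≤ ·) R (S \ A) (n + 1)).card : ℚ) := by
  have key : ∀ c : W → ℕ, ∑ A ∈ (maxes R S).powerset,
      (-1 : ℚ) ^ A.card * (if ∀ x ∈ A, c x = n then 1 else 0)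
        = if (maxes R S).filter (fun x => c x = n) = ∅ then 1 else 0 := by
    intro c
    have h1 := Finset.sum_powerset_neg_one_pow_card (x := (maxes R S).filter (fun x => c x = n))
    have h2 : ((maxes R S).powerset.filter fun A => ∀ x ∈ A, c x = n)
        = ((maxes R S).filter (fun x => c x = n)).powerset := by
      ext A
      simp only [mem_filter, mem_powerset, subset_iff]
      grind
    simp only [mul_ite, mul_one, mul_zero]
    rw [← sum_filter, h2]
    exact_mod_cast congrArg (Int.cast : ℤ → ℚ) h1
  rw [← filter_weak_eq hR S n, card_filter]
  push_cast
  simp_rw [← key]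
  rw [sum_comm]
  refine sum_congr rfl fun A hA => ?_
  rw [← card_weak_top (mem_powerset.1 hA) n, card_filter, ← mul_sum]
  push_cast
  rfl

/-- Faulhaber's formula on monomials, extended by linearity. -/
theorem exists_sum_range_eval (Q : ℚ[X]) :
    ∃ P : ℚ[X], ∀ n : ℕ, P.eval (n : ℚ) = ∑ k ∈ range n, Q.eval (k : ℚ) := by
  induction Q using Polynomial.induction_on' with
  | add p q hp hq =>
    obtain ⟨P, hP⟩ := hp
    obtain ⟨Q, hQ⟩ := hq
    exact ⟨P + Q, fun n => by simp [hP, hQ, sum_add_distrib]⟩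
  | monomial p a =>
    refine ⟨C a * ∑ i ∈ range (p + 1), C (_root_.bernoulli i * ((p + 1).choose i) / (p + 1)) *
      X ^ (p + 1 - i), fun n => ?_⟩
    simp only [eval_mul, eval_C, eval_finsetSum, eval_pow, eval_X, eval_monomial]
    rw [← mul_sum, sum_range_pow]
    congr 1
    exact sum_congr rfl fun i _ => by ring

/-- Induction on `S`. The strict recursion expresses the first difference of the count through
smaller sets, so the count is a polynomial; the same difference equation, read at negative
arguments, is the weak recursion up to sign. -/
theorem exists_polynomial_finset {R : W → W → Prop} (hR : WellFounded (flip R)) (S : Finset W) :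
    ∃ P : ℚ[X], (∀ n : ℕ, P.eval (n : ℚ) = (maps (· < ·) R S n).card) ∧
      ∀ n : ℕ, P.eval (-(n : ℚ)) = (-1) ^ S.card * (maps (· ≤ ·) R S n).card := by
  induction S using Finset.strongInduction with
  | H S ih =>
  have hsub : ∀ A ∈ (maxes R S).powerset.erase ∅, A ⊆ S ∧ S \ A ⊂ S := fun A hA => by
    rw [mem_erase, mem_powerset] at hA
    have hAS : A ⊆ S := fun x hx => (mem_maxes.1 (hA.2 hx)).1
    refine ⟨hAS, sdiff_ssubset hAS (nonempty_iff_ne_empty.2 hA.1)⟩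
  -- The empty `A` is left out because it gives back `S` itself; a junk polynomial is chosen where
  -- the induction hypothesis does not apply.
  have : ∀ A : Finset W, ∃ P : ℚ[X], A ∈ (maxes R S).powerset.erase ∅ →
      (∀ n : ℕ, P.eval (n : ℚ) = (maps (· < ·) R (S \ A) n).card) ∧
      ∀ n : ℕ, P.eval (-(n : ℚ)) = (-1) ^ (S \ A).card * (maps (· ≤ ·) R (S \ A) n).card := by
    intro A
    by_cases hA : A ∈ (maxes R S).powerset.erase ∅
    · obtain ⟨P, hP⟩ := ih _ (hsub A hA).2
      exact ⟨P, fun _ => hP⟩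
    · exact ⟨0, fun h => absurd h hA⟩
  choose p hp using this
  obtain ⟨P₀, hP₀⟩ := exists_sum_range_eval (∑ A ∈ (maxes R S).powerset.erase ∅, p A)
  set P := P₀ + C ((maps (· < ·) R S 0).card : ℚ) with hPdef
  have hsucc : ∀ n : ℕ, P.eval ((n : ℚ) + 1) = P.eval (n : ℚ) +
      (∑ A ∈ (maxes R S).powerset.erase ∅, p A).eval (n : ℚ) := fun n => by
    have h1 := hP₀ (n + 1)
    rw [sum_range_succ, ← hP₀ n] at h1
    push_cast at h1
    simp only [hPdef, eval_add, eval_C, h1]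
    ring
  -- The difference equation holds at all naturals, hence as an identity of polynomials, which may
  -- then be evaluated at negative arguments.
  have hpoly : P.comp (X + 1) = P + ∑ A ∈ (maxes R S).powerset.erase ∅, p A := by
    refine Polynomial.eq_of_infinite_eval_eq _ _ ?_
    refine (Set.infinite_range_of_injective (Nat.cast_injective (R := ℚ))).mono ?_
    rintro _ ⟨n, rfl⟩
    have := hsucc n
    simpa using this
  have hempty : ∅ ∈ (maxes R S).powerset := empty_mem_powerset _
  have hstrict : ∀ n : ℕ, P.eval (n : ℚ) = (maps (· < ·) R S n).card := by
    intro n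
    induction n with
    | zero =>
      have := hP₀ 0
      simp only [range_zero, sum_empty] at this
      simpa [hPdef] using this
    | succ n ihn =>
      rw [card_strict_succ, ← add_sum_erase _ _ hempty]
      push_cast
      rw [hsucc, ihn, sdiff_empty, eval_finsetSum]
      congr 1
      exact sum_congr rfl fun A hA => (hp A hA).1 n
  refine ⟨P, hstrict, fun n => ?_⟩
  induction n with
  | zero =>
    rw [Nat.cast_zero, neg_zero]
    have h0 := hstrict 0
    rw [Nat.cast_zero] at h0
    rw [h0]
    -- With no colors the counts are `0` unless `S` is empty, where the sign is `1`.
    rcases S.eq_empty_or_nonempty with rfl | ⟨x, hx⟩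
    · simp [maps]
    · have : ∀ r, maps r R S 0 = ∅ := fun r =>
        eq_empty_of_forall_notMem fun c hc => absurd ((mem_maps.1 hc).1 x hx) (Nat.not_lt_zero _)
      simp [this]
  | succ n ihn =>
    have h1 := congrArg (Polynomial.eval (-((n : ℚ) + 1))) hpoly
    simp only [eval_comp, eval_add, eval_X, eval_one, eval_finsetSum] at h1
    rw [show -((n : ℚ) + 1) + 1 = -n by ring, ihn, card_weak_eq_sum hR S n,
      ← add_sum_erase _ _ hempty, mul_add, mul_sum] at h1
    -- The signs for `S \ A` and `S` differ by `(-1) ^ A.card`, the inclusion–exclusion sign.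
    have h2 : ∀ A ∈ (maxes R S).powerset.erase ∅, (p A).eval (-((n : ℚ) + 1))
        = (-1) ^ S.card * ((-1) ^ A.card * ((maps (· ≤ ·) R (S \ A) (n + 1)).card : ℚ)) := by
      intro A hA
      have h3 := (hp A hA).2 (n + 1)
      push_cast at h3
      rw [h3, ← card_sdiff_add_card_eq_card (hsub A hA).1, pow_add, ← mul_assoc]
      congr 1
      rw [mul_assoc, ← mul_pow]
      simp
    rw [sum_congr rfl h2] at h1
    have h4 := add_right_cancel h1
    push_cast
    rw [← h4]
    simp

theorem card_maps_univ (r : ℕ → ℕ → Prop) (R : W → W → Prop) (n : ℕ) :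
    (maps r R univ n).card
      = Nat.card {c : W → Fin n // ∀ x y, R x y → r (c x) (c y)} := by
  rw [← Nat.card_eq_finsetCard]
  refine Nat.card_congr
    { toFun c := ⟨fun x => ⟨c.1 x, (mem_maps.1 c.2).1 x (mem_univ x)⟩, fun x y =>
        (mem_maps.1 c.2).2.2 x (mem_univ x) y (mem_univ y)⟩
      invFun c := ⟨fun x => c.1 x, mem_maps.2 ⟨fun x _ => (c.1 x).2,
        fun x hx => absurd (mem_univ x) hx, fun x _ y _ => c.2 x y⟩⟩
      left_inv _ := rfl
      right_inv _ := rfl }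

end

/-- Reciprocity for order polynomials. -/
theorem exists_polynomial (K : Type*) [Field K] [CharZero K] {W : Type*} [Finite W]
    {R : W → W → Prop} (hR : WellFounded (flip R)) :
    ∃ P : K[X],
      (∀ n : ℕ, P.eval (n : K) = Nat.card {c : W → Fin n // ∀ x y, R x y → c x < c y}) ∧
      ∀ n : ℕ, P.eval (-(n : K))
        = (-1) ^ Nat.card W * Nat.card {c : W → Fin n // ∀ x y, R x y → c x ≤ c y} := by
  classical
  have := Fintype.ofFinite W
  obtain ⟨P, h1, h2⟩ := exists_polynomial_finset hR (univ : Finset W)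
  -- The rational polynomial is transported to `K`, which contains `ℚ`.
  have hev : ∀ a : ℚ, (P.map (algebraMap ℚ K)).eval (a : K) = ((P.eval a : ℚ) : K) := fun a => by
    have := Polynomial.eval_map_algebraMap (B := K) P (algebraMap ℚ K a)
    rw [Polynomial.aeval_algebraMap_apply] at this
    simpa using this
  refine ⟨P.map (algebraMap ℚ K), fun n => ?_, fun n => ?_⟩
  · have := hev n
    rw [h1, card_maps_univ] at this
    simpa using this
  · have := hev (-n)
    rw [h2, card_maps_univ] at this
    simpa using this

end OrderPolynomial

/-! ### The invariant as a sum over colorings -/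

namespace GraphHopf

/-- The decomposition into the color classes of a coloring. -/
def colorClasses {α : Type u} {V : Finset α} {n : ℕ} (c : V → Fin n) : Decomposition V n where
  parts i := (Finset.univ.filter fun v => c v = i).map (Function.Embedding.subtype _)
  disj i j hij := by
    rw [Finset.disjoint_left]
    intro a hi hj
    simp only [Finset.mem_map, Finset.mem_filter] at hi hj
    obtain ⟨x, hx, rfl⟩ := hi
    obtain ⟨y, hy, hyx⟩ := hj
    have := Subtype.val_injective hyx
    exact hij (hx.2.symm.trans (this ▸ hy.2))
  mem_iff a := by simp

theorem mem_colorClasses {α : Type u} {V : Finset α} {n : ℕ} {c : V → Fin n} {i : Fin n} {a : α} :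
    a ∈ (colorClasses c).parts i ↔ ∃ h : a ∈ V, c ⟨a, h⟩ = i := by
  simp [colorClasses]

theorem val_mem_colorClasses {α : Type u} {V : Finset α} {n : ℕ} {c : V → Fin n} {i : Fin n}
    {x : V} : (x : α) ∈ (colorClasses c).parts i ↔ c x = i := by
  simp [mem_colorClasses]

theorem colorClasses_bijective {α : Type u} {V : Finset α} {n : ℕ} :
    Function.Bijective (colorClasses : (V → Fin n) → Decomposition V n) := by
  constructor
  · intro c c' h
    funext x
    have : (x : α) ∈ (colorClasses c').parts (c x) := h ▸ val_mem_colorClasses.2 rfl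
    exact (val_mem_colorClasses.1 this).symm
  · intro D
    choose c hc using fun x : V => (D.mem_iff x).1 x.2
    refine ⟨c, Decomposition.parts_injective V n ?_⟩
    funext i
    ext a
    rw [mem_colorClasses]
    constructor
    · rintro ⟨h, rfl⟩
      exact hc ⟨a, h⟩
    · intro h
      refine ⟨(D.mem_iff a).2 ⟨i, h⟩, ?_⟩
      by_contra hne
      exact Finset.disjoint_left.1 (D.disj _ _ hne) (hc ⟨a, _⟩) h

namespace Multigraph

variable {α : Type u} {V : Finset α}

/-- `g|_{V₁} ⊔ ⋯ ⊔ g|_{Vₙ}` for a decomposition `(V₁, …, Vₙ)`. -/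
noncomputable def decompose (g : Multigraph V) {n : ℕ} (D : Decomposition V n) :
    Multigraph V where
  edges := ∑ i, (g.restrict (D.parts i)).edges
  subset e he := by
    classical
    obtain ⟨i, _, hi⟩ := Multiset.mem_sum.1 he
    exact g.subset e (Multiset.mem_filter.1 hi).1
  card_eq e he := by
    classical
    obtain ⟨i, _, hi⟩ := Multiset.mem_sum.1 he
    exact g.card_eq e (Multiset.mem_filter.1 hi).1

theorem decompose_succ (g : Multigraph V) {n : ℕ} (D : Decomposition V (n + 1)) :
    g.decompose D = union D.isSplit (g.restrict (D.parts 0))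
      ((g.restrict _).decompose D.tail) := by
  ext1
  simp only [decompose, union]
  rw [Fin.sum_univ_succ]
  congr 1
  refine Finset.sum_congr rfl fun i _ => ?_
  rw [restrict_restrict fun a ha => (D.tail.mem_iff a).2 ⟨i, ha⟩]
  rfl

theorem eq_of_decomposition_zero (D : Decomposition V 0) (g g' : Multigraph V) : g = g' := by
  obtain rfl : V = ∅ := Finset.eq_empty_of_forall_notMem fun a ha => by
    obtain ⟨i, _⟩ := (D.mem_iff a).1 ha
    exact i.elim0
  exact eq_of_empty g g'

theorem mulComul_toG (K : Type w) [Field K] {n : ℕ} {V : Finset α} (D : Decomposition V n)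
    (g : Multigraph V) :
    (graphMonoid K).mulComul n D (g.toG K) = (g.decompose D).toG K := by
  induction n generalizing V with
  -- A decomposition without parts forces `V = ∅`, over which there is only one graph.
  | zero => exact congrArg (toG K) (eq_of_decomposition_zero D _ _)
  | succ n ih =>
    simp only [HopfMonoid.mulComul, LinearMap.comp_apply]
    rw [graphMonoid_comul_toG, TensorProduct.map_tmul, ih, LinearMap.id_apply,
      graphMonoid_mul_toG, decompose_succ]

theorem toFun_decompose {K : Type w} [Field K] (ζ : (graphMonoid.{u, w} K).Character) {n : ℕ}
    {V : Finset α} (D : Decomposition V n) (g : Multigraph V) :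
    ζ.toFun V ((g.decompose D).toG K)
      = ∏ i, ζ.toFun (D.parts i) ((g.restrict (D.parts i)).toG K) := by
  induction n generalizing V with
  | zero =>
    obtain rfl : V = ∅ := Finset.eq_empty_of_forall_notMem fun a ha => by
      obtain ⟨i, _⟩ := (D.mem_iff a).1 ha
      exact i.elim0
    rw [eq_of_empty (g.decompose D) (discrete ∅)]
    refine Eq.trans (congrArg (ζ.toFun ∅) ?_) ((ζ.map_unit α).trans (by simp))
    exact (Finsupp.uniqueLinearEquiv_symm_apply K K (discrete (∅ : Finset α)) 1).symm
  | succ n ih =>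
    rw [decompose_succ, ← graphMonoid_mul_toG, ζ.map_mul, ih, Fin.prod_univ_succ]
    congr 1
    refine Finset.prod_congr rfl fun i _ => ?_
    rw [restrict_restrict fun a ha => (D.tail.mem_iff a).2 ⟨i, ha⟩]
    rfl

open scoped Classical in
/-- The subgraph formed by the edges on which the coloring `c` is constant. -/
noncomputable def mono (g : Multigraph V) {ι : Type*} (c : V → ι) : Multigraph V where
  edges := g.edges.filter fun e => ∀ x y : V, (x : α) ∈ e → (y : α) ∈ e → c x = c y
  subset e he := g.subset e (Multiset.mem_filter.1 he).1
  card_eq e he := g.card_eq e (Multiset.mem_filter.1 he).1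

theorem mem_mono_edges {g : Multigraph V} {ι : Type*} {c : V → ι} {e : Finset α} :
    e ∈ (g.mono c).edges ↔
      e ∈ g.edges ∧ ∀ x y : V, (x : α) ∈ e → (y : α) ∈ e → c x = c y := by
  simp only [mono, Multiset.mem_filter]

theorem mono_edges_le (g : Multigraph V) {ι : Type*} (c : V → ι) :
    (g.mono c).edges ≤ g.edges := by
  simp only [mono, Multiset.filter_le]

theorem mono_congr (g : Multigraph V) {ι κ : Type*} {c : V → ι} {d : V → κ}
    (h : ∀ x y, c x = c y ↔ d x = d y) : g.mono c = g.mono d := by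
  classical
  ext1
  simp only [mono]
  exact Multiset.filter_congr fun e _ => by simp only [h]

theorem mono_eq_self {g : Multigraph V} {ι : Type*} {c : V → ι}
    (h : ∀ e ∈ g.edges, ∀ x y : V, (x : α) ∈ e → (y : α) ∈ e → c x = c y) : g.mono c = g := by
  classical
  ext1
  simp only [mono]
  exact Multiset.filter_eq_self.2 h

/-- A monochromatic edge is nonempty, so it lies in exactly one color class and is counted with its
own multiplicity; any other edge lies in none. -/
theorem decompose_colorClasses (g : Multigraph V) {n : ℕ} (c : V → Fin n) :
    g.decompose (colorClasses c) = g.mono c := by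
  classical
  ext1
  ext e
  simp only [decompose, mono, restrict, Multiset.count_sum', Multiset.count_filter]
  by_cases he : e ∈ g.edges
  · obtain ⟨a, ha⟩ : e.Nonempty := Finset.card_pos.1 (by rw [g.card_eq e he]; norm_num)
    have haV := g.subset e he ha
    have key : ∀ i, e ⊆ (colorClasses c).parts i ↔
        (∀ x y : V, (x : α) ∈ e → (y : α) ∈ e → c x = c y) ∧ c ⟨a, haV⟩ = i := by
      intro i
      constructor
      · intro h
        refine ⟨fun x y hx hy => ?_, val_mem_colorClasses.1 (h ha)⟩
        rw [val_mem_colorClasses.1 (h hx), val_mem_colorClasses.1 (h hy)]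
      · rintro ⟨h, rfl⟩ b hb
        exact mem_colorClasses.2 ⟨g.subset e he hb, h _ _ hb ha⟩
    simp only [key]
    by_cases hm : ∀ x y : V, (x : α) ∈ e → (y : α) ∈ e → c x = c y
    · rw [if_pos hm]
      simp only [and_iff_right hm]
      simp
    · rw [if_neg hm]
      simp only [hm, false_and, if_false, Finset.sum_const_zero]
  · simp [Multiset.count_eq_zero_of_notMem he]

open scoped Classical in
theorem chi_toG {K : Type w} [Field K] (ζ : (graphMonoid.{u, w} K).Character)
    (g : Multigraph V) (n : ℕ) :
    (graphMonoid K).chi ζ (g.toG K) n = ∑ c : V → Fin n, ζ.toFun V ((g.mono c).toG K) := by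
  rw [HopfMonoid.chi]
  refine (Fintype.sum_bijective colorClasses colorClasses_bijective _ _ fun c => ?_).symm
  rw [mulComul_toG, decompose_colorClasses]

/-- Flats require nonempty parts, so the colors actually used are renumbered; this does not change
which edges are monochromatic. -/
theorem isFlat_mono (g : Multigraph V) {n : ℕ} (c : V → Fin n) : g.IsFlat (g.mono c) := by
  classical
  let S := Finset.univ.image c
  obtain ⟨e⟩ : Nonempty (S ≃ Fin S.card) := ⟨S.equivFin⟩
  let c' : V → Fin S.card := fun x => e ⟨c x, Finset.mem_image_of_mem _ (Finset.mem_univ x)⟩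
  refine ⟨S.card, colorClasses c', fun i => ?_, ?_⟩
  · obtain ⟨x, _, hx⟩ := Finset.mem_image.1 (e.symm i).2
    refine ⟨x, val_mem_colorClasses.2 ?_⟩
    rw [← e.apply_symm_apply i]
    exact congrArg e (Subtype.ext hx)
  · change _ = (g.decompose (colorClasses c')).edges
    rw [decompose_colorClasses]
    exact congrArg edges (mono_congr g fun x y => by simp [c'])

/-! ## Edges and components -/

theorem exists_ends_eq {g : Multigraph V} {e : Finset α} (he : e ∈ g.edges) :
    ∃ x y : V, x ≠ y ∧ ∀ v : V, (v : α) ∈ e ↔ v = x ∨ v = y := by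
  classical
  obtain ⟨a, b, hab, rfl⟩ := Finset.card_eq_two.1 (g.card_eq e he)
  refine ⟨⟨a, g.subset _ he (by simp)⟩, ⟨b, g.subset _ he (by simp)⟩, by simpa using hab, ?_⟩
  rintro ⟨v, hv⟩
  simp

theorem connectedComponentMk_eq {g : Multigraph V} {e : Finset α} (he : e ∈ g.edges) {x y : V}
    (hx : (x : α) ∈ e) (hy : (y : α) ∈ e) :
    g.toSimple.connectedComponentMk x = g.toSimple.connectedComponentMk y := by
  by_cases h : x = y
  · rw [h]
  · exact SimpleGraph.ConnectedComponent.eq.2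
      (SimpleGraph.Adj.reachable (show g.toSimple.Adj x y from ⟨h, e, he, hx, hy⟩))

/-- Colorings that are constant on every edge correspond to colorings of the components. -/
theorem exists_lift {g : Multigraph V} {ι : Type*} {c : V → ι}
    (hc : ∀ e ∈ g.edges, ∀ x y : V, (x : α) ∈ e → (y : α) ∈ e → c x = c y) :
    ∃ d : g.Component → ι, ∀ x, d (g.toSimple.connectedComponentMk x) = c x := by
  refine ⟨SimpleGraph.ConnectedComponent.lift c ?_, fun x => rfl⟩
  intro x y p _
  induction p with
  | nil => rfl
  | cons h _ ih =>
    obtain ⟨_, e, he, hx, hy⟩ := h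
    rename_i hp
    exact (hc e he _ _ hx hy).trans (ih hp.of_cons)

/-- A walk between two vertices of one component never leaves it, so it survives the restriction to
that component. -/
theorem restrict_colorClass_connected {g : Multigraph V} {n : ℕ} {e : g.Component ≃ Fin n}
    (i : Fin n) :
    (g.restrict ((colorClasses fun x => e (g.toSimple.connectedComponentMk x)).parts i)).Connected
    := by
  classical
  set c : V → Fin n := fun x => e (g.toSimple.connectedComponentMk x) with hc
  set A := (colorClasses c).parts i with hA
  have key : ∀ x y : V, g.toSimple.Walk x y → ∀ (hx : (x : α) ∈ A) (hy : (y : α) ∈ A),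
      (g.restrict A).toSimple.Reachable ⟨x, hx⟩ ⟨y, hy⟩ := by
    intro x y p
    induction p with
    | nil => exact fun _ _ => SimpleGraph.Reachable.refl _
    | @cons x z y h p ih =>
      intro hx hy
      have hz : (z : α) ∈ A := by
        rw [hA, val_mem_colorClasses] at hx ⊢
        rw [← hx]
        exact congrArg e (SimpleGraph.ConnectedComponent.eq.2 h.symm.reachable)
      refine SimpleGraph.Reachable.trans (SimpleGraph.Adj.reachable ?_) (ih hz hy)
      obtain ⟨hne, a, ha, hxa, hza⟩ := h
      refine ⟨fun h => hne (Subtype.ext (congrArg (fun v : A => (v : α)) h)), a,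
        Multiset.mem_filter.2 ⟨ha, fun b hb => ?_⟩, hxa, hza⟩
      have h1 : c ⟨b, g.subset a ha hb⟩ = c x :=
        congrArg e (connectedComponentMk_eq ha (by exact hb) hxa)
      rw [hA, val_mem_colorClasses] at hx
      exact mem_colorClasses.2 ⟨_, h1.trans hx⟩
  obtain ⟨x, hx⟩ := Quot.exists_rep (e.symm i)
  have hxA : (x : α) ∈ A := val_mem_colorClasses.2 (by
    rw [hc, ← e.apply_symm_apply i]; exact congrArg e hx)
  have : Nonempty A := ⟨⟨x, hxA⟩⟩
  refine SimpleGraph.Connected.mk fun y z => ?_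
  obtain ⟨hy, hy'⟩ := mem_colorClasses.1 y.2
  obtain ⟨hz, hz'⟩ := mem_colorClasses.1 z.2
  obtain ⟨p⟩ : g.toSimple.Reachable ⟨y, hy⟩ ⟨z, hz⟩ :=
    SimpleGraph.ConnectedComponent.eq.1 (e.injective (hy'.trans hz'.symm))
  exact key _ _ p y.2 z.2

/-- By multiplicativity `ζ(g)` is the product of its values on the components. None of them
vanishes, so `|V|` is a sum of `cc` odd numbers. -/
theorem neg_one_pow_cc {K : Type w} [Field K] {ζ : (graphMonoid.{u, w} K).Character}
    (hζ : IsOdd ζ) (g : Multigraph V) (hg : ζ.toFun V (g.toG K) ≠ 0) :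
    (-1 : K) ^ V.card * (-1) ^ g.cc = 1 := by
  classical
  have := Fintype.ofFinite g.Component
  obtain ⟨e⟩ : Nonempty (g.Component ≃ Fin g.cc) := ⟨Finite.equivFin _⟩
  -- Coloring each vertex by its component makes `g` its own monochromatic subgraph.
  let c : V → Fin g.cc := fun x => e (g.toSimple.connectedComponentMk x)
  have hmono : g.mono c = g := by
    exact mono_eq_self fun a ha x y hx hy => congrArg e (connectedComponentMk_eq ha hx hy)
  rw [← hmono, ← decompose_colorClasses, toFun_decompose, Finset.prod_ne_zero_iff] at hg
  have hodd : ∀ i, Odd ((colorClasses c).parts i).card := fun i =>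
    hζ _ (restrict_colorClass_connected (e := e) i) (hg i (Finset.mem_univ i))
  have hcard : V.card = ∑ i, ((colorClasses c).parts i).card := by
    simp only [colorClasses, Finset.card_map]
    rw [← Fintype.card_coe V, ← Finset.card_univ]
    exact Finset.card_eq_sum_card_fiberwise fun _ _ => Finset.mem_coe.2 (Finset.mem_univ _)
  have h1 : (-1 : K) ^ V.card = (-1) ^ g.cc := by
    rw [hcard, ← Finset.prod_pow_eq_pow_sum, Finset.prod_congr rfl fun i _ => (hodd i).neg_one_pow]
    simp
  rw [h1, ← mul_pow]
  simp

end Multigraph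
end GraphHopf

/-! ### Partial orientations and compatible colorings -/

namespace GraphHopf.Multigraph.PartialOrientation

variable {α : Type u} {V : Finset α} {g : Multigraph V}

theorem mem_ends_cases (e : g.Edge) : ∃ x y : V, x ≠ y ∧ ∀ v, v ∈ g.ends e ↔ v = x ∨ v = y := by
  classical
  exact exists_ends_eq (g := g) (e := e.1) Multiset.coe_mem

theorem isCompatible_iff {f : g.PartialOrientation} {n : ℕ} {c : V → Fin n} :
    f.IsCompatible c ↔ ∀ e, (∀ v, f.1 e = some v → ∀ w ∈ g.ends e, c w ≤ c v) ∧
      (f.1 e = none → ∀ v ∈ g.ends e, ∀ w ∈ g.ends e, c v = c w) := by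
  refine forall_congr' fun e => and_congr ?_ ?_
  · exact forall_congr' fun v => forall_congr' fun hv => and_iff_right (f.2 e v hv)
  · refine forall_congr' fun _ => ⟨fun h v hv w hw => ?_, fun h => ?_⟩
    · rw [← h] at hv hw
      exact le_antisymm (hw.2 v hv.1) (hv.2 w hw.1)
    · ext v
      exact and_iff_left_of_imp fun hv w hw => (h w hw v hv).le

theorem isStrictlyCompatible_iff {f : g.PartialOrientation} {n : ℕ} {c : V → Fin n} :
    f.IsStrictlyCompatible c ↔
      ∀ e, (∀ v, f.1 e = some v → ∀ w ∈ g.ends e, w ≠ v → c w < c v) ∧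
      (f.1 e = none → ∀ v ∈ g.ends e, ∀ w ∈ g.ends e, c v = c w) := by
  refine forall_congr' fun e => and_congr ?_ ?_
  · refine forall_congr' fun v => forall_congr' fun hv => ⟨fun h w hw hne => ?_, fun h => ?_⟩
    · have hv' : v ∈ maxVertices g c e := h ▸ Set.mem_singleton v
      refine lt_of_le_of_ne (hv'.2 w hw) fun heq => hne ?_
      have : w ∈ maxVertices g c e := ⟨hw, fun u hu => heq ▸ hv'.2 u hu⟩
      rwa [← h] at this
    · ext w
      constructor
      · rintro rfl
        refine ⟨f.2 e w hv, fun u hu => ?_⟩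
        by_cases huw : u = w
        · rw [huw]
        · exact (h u hu huw).le
      · rintro ⟨hw, hmax⟩
        by_contra hne
        exact (h w hw hne).not_ge (hmax v (f.2 e v hv))
  · refine forall_congr' fun _ => ⟨fun h v hv w hw => ?_, fun h => ?_⟩
    · rw [← h] at hv hw
      exact le_antisymm (hw.2 v hv.1) (hv.2 w hw.1)
    · ext v
      exact and_iff_left_of_imp fun hv w hw => (h w hw v hv).le

/-- Each edge is oriented towards its end of larger color, and left unoriented when the colors
agree. -/
theorem exists_isStrictlyCompatible {n : ℕ} (c : V → Fin n) :
    ∃ f : g.PartialOrientation, f.IsStrictlyCompatible c := by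
  have : ∀ e : g.Edge, ∃ o : Option V, (∀ v, o = some v → v ∈ g.ends e) ∧
      (∀ v, o = some v → ∀ w ∈ g.ends e, w ≠ v → c w < c v) ∧
      (o = none → ∀ v ∈ g.ends e, ∀ w ∈ g.ends e, c v = c w) := by
    intro e
    obtain ⟨x, y, hxy, h⟩ := mem_ends_cases e
    rcases lt_trichotomy (c x) (c y) with hlt | heq | hlt
    · refine ⟨some y, ?_, ?_, ?_⟩ <;> simp [h, hlt]
    · refine ⟨none, ?_, ?_, ?_⟩ <;> simp [h, heq]
    · refine ⟨some x, ?_, ?_, ?_⟩ <;> simp [h, hlt]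
  choose f hf using this
  exact ⟨⟨f, fun e v => (hf e).1 v⟩, isStrictlyCompatible_iff.2 fun e => (hf e).2⟩

theorem IsStrictlyCompatible.eq {f f' : g.PartialOrientation} {n : ℕ} {c : V → Fin n}
    (h : f.IsStrictlyCompatible c) (h' : f'.IsStrictlyCompatible c) : f = f' := by
  rw [isStrictlyCompatible_iff] at h h'
  refine Subtype.ext (funext fun e => ?_)
  obtain ⟨x, y, hxy, hends⟩ := mem_ends_cases e
  have key : ∀ f₁ f₂ : g.PartialOrientation, ∀ v, f₁.1 e = some v →
      (∀ w ∈ g.ends e, w ≠ v → c w < c v) →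
      (∀ v, f₂.1 e = some v → ∀ w ∈ g.ends e, w ≠ v → c w < c v) →
      (f₂.1 e = none → ∀ v ∈ g.ends e, ∀ w ∈ g.ends e, c v = c w) → f₂.1 e = some v := by
    intro f₁ f₂ v hv h1 h2 h3
    have hve := f₁.2 e v hv
    cases hv2 : f₂.1 e with
    | some v' =>
      by_contra hne
      have hne : v ≠ v' := fun h => hne (h ▸ rfl)
      exact lt_asymm (h2 v' hv2 v hve hne) (h1 v' (f₂.2 e v' hv2) hne.symm)
    | none =>
      exfalso
      obtain ⟨w, hw, hwv⟩ : ∃ w ∈ g.ends e, w ≠ v := by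
        by_cases hxv : x = v
        · exact ⟨y, (hends y).2 (Or.inr rfl), fun h => hxy (hxv.trans h.symm)⟩
        · exact ⟨x, (hends x).2 (Or.inl rfl), hxv⟩
      exact (h1 w hw hwv).ne (h3 hv2 w hw v hve)
  cases hf : f.1 e with
  | some v => exact (key f f' v hf ((h e).1 v hf) (h' e).1 (h' e).2).symm
  | none =>
    cases hf' : f'.1 e with
    | none => rfl
    | some v =>
      have := key f' f v hf' ((h' e).1 v hf') (h e).1 (h e).2
      rw [hf] at this
      exact this

theorem mem_image_edges {f : g.PartialOrientation} {a : Finset α} :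
    a ∈ f.image.edges ↔ ∃ e, f.1 e = none ∧ e.1 = a := by
  simp [image]

theorem image_edges_eq_zero_iff {f : g.PartialOrientation} :
    f.image.edges = 0 ↔ f.IsDiscrete := by
  rw [Multiset.eq_zero_iff_forall_notMem]
  constructor
  · intro h e he
    exact h e.1 (mem_image_edges.2 ⟨e, he, rfl⟩)
  · intro h a ha
    obtain ⟨e, he, _⟩ := mem_image_edges.1 ha
    exact h e he

theorem IsStrictlyCompatible.eq_none_iff {f : g.PartialOrientation} {n : ℕ} {c : V → Fin n}
    (h : f.IsStrictlyCompatible c) (e : g.Edge) : f.1 e = none ↔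
      ∀ x y : V, (x : α) ∈ e.1 → (y : α) ∈ e.1 → c x = c y := by
  rw [isStrictlyCompatible_iff] at h
  refine ⟨fun he x y hx hy => (h e).2 he x hx y hy, fun he => ?_⟩
  cases hv : f.1 e with
  | none => rfl
  | some v =>
    exfalso
    obtain ⟨x, y, hxy, hends⟩ := mem_ends_cases e
    have hx : x ∈ g.ends e := (hends x).2 (Or.inl rfl)
    have hy : y ∈ g.ends e := (hends y).2 (Or.inr rfl)
    rcases (hends v).1 (f.2 e v hv) with rfl | rfl
    · exact ((h e).1 v hv y hy hxy.symm).ne (he _ _ hy hx)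
    · exact ((h e).1 v hv x hx hxy).ne (he _ _ hx hy)

-- Passes between filtering labelled copies of edges, as orientations do, and filtering the multiset
-- of edges, as `mono` does.
open scoped Classical in
theorem map_filter_edges (g : Multigraph V) (p : Finset α → Prop) (q : g.Edge → Prop)
    {_ : DecidablePred p} {_ : DecidablePred q} (h : ∀ e, q e ↔ p e.1) :
    ((Finset.univ : Finset g.Edge).filter q).val.map (fun e => e.1) = g.edges.filter p := by
  have huniv : (Finset.univ : Finset g.Edge).val.map (fun e => e.1) = g.edges :=
    Multiset.map_univ_coe g.edges
  conv_rhs => rw [← huniv, Multiset.filter_map]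
  rw [Finset.filter_val]
  exact congrArg _ (Multiset.filter_congr fun e _ => h e)

theorem IsStrictlyCompatible.image_eq {f : g.PartialOrientation} {n : ℕ} {c : V → Fin n}
    (h : f.IsStrictlyCompatible c) : f.image = g.mono c :=
  Multigraph.ext (by simpa only [image, mono] using map_filter_edges g _ _ h.eq_none_iff)

/-! ## Acyclicity -/

theorem kappa_of_some {f : g.PartialOrientation} {e : g.Edge} {v : V} (h : f.1 e = some v) :
    kappa f e = {v} := by
  simp [kappa, h]

theorem kappa_of_none {f : g.PartialOrientation} {e : g.Edge} (h : f.1 e = none) :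
    kappa f e = g.ends e := by
  simp [kappa, h]

theorem mem_source {f : g.PartialOrientation} {e : g.Edge} {w : V} :
    w ∈ source f e ↔ ∃ v, f.1 e = some v ∧ w ∈ g.ends e ∧ w ≠ v := by
  cases h : f.1 e with
  | none => simp [source, kappa_of_none h]
  | some v => simp [source, kappa_of_some h]

/-- Along a forbidden sequence starting at an oriented edge with head `v`, all vertices of the sets
`κ_f` have color at least `c v`; closing the cycle would put a source of that edge, of smaller
color, among them. -/
theorem IsStrictlyCompatible.isAcyclic {f : g.PartialOrientation} {n : ℕ} {c : V → Fin n}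
    (h : f.IsStrictlyCompatible c) : f.IsAcyclic := by
  rw [isStrictlyCompatible_iff] at h
  rintro ⟨k, e, -, hstep, s, hsk, hs0⟩
  obtain ⟨v, hv, hs, hsv⟩ := mem_source.1 hs0
  have key : ∀ i, ∀ x ∈ kappa f (e i), c v ≤ c x := by
    intro i
    induction i using Fin.induction with
    | zero =>
      intro x hx
      rw [kappa_of_some hv] at hx
      rw [Set.mem_singleton_iff.1 hx]
    | succ i ih =>
      obtain ⟨y, hy, hye⟩ : (kappa f (e i.castSucc) ∩ g.ends (e i.succ)).Nonempty := by
        rcases hstep i with ⟨y, hy, hy'⟩ | ⟨hne, _⟩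
        · exact ⟨y, hy, hy'.1⟩
        · exact hne
      intro x hx
      refine (ih y hy).trans ?_
      cases hx' : f.1 (e i.succ) with
      | none =>
        rw [kappa_of_none hx'] at hx
        exact ((h _).2 hx' y hye x hx).le
      | some z =>
        rw [kappa_of_some hx', Set.mem_singleton_iff] at hx
        subst hx
        by_cases hyx : y = x
        · rw [hyx]
        · exact ((h _).1 x hx' y hye hyx).le
  exact (key _ s hsk).not_gt ((h _).1 v hv s hs hsv)

/-- One step of a directed path: oriented edges are followed towards `f e`, the other ones in both
directions. -/
def Step (f : g.PartialOrientation) (x y : V) : Prop :=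
  ∃ e, x ∈ g.ends e ∧ y ∈ g.ends e ∧ x ≠ y ∧ (f.1 e = none ∨ f.1 e = some y)

/-- A path of minimal length repeats no vertex, since the loop between two visits could be cut out.
-/
theorem exists_injOn_path {X : Type*} {r : X → X → Prop} {a b : X}
    (h : Relation.ReflTransGen r a b) :
    ∃ (k : ℕ) (x : ℕ → X), x 0 = a ∧ x k = b ∧ (∀ i < k, r (x i) (x (i + 1))) ∧
      ∀ i j, i < j → j ≤ k → x i ≠ x j := by
  classical
  have hex : ∃ k, ∃ x : ℕ → X, x 0 = a ∧ x k = b ∧ ∀ i < k, r (x i) (x (i + 1)) := by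
    induction h with
    | refl => exact ⟨0, fun _ => a, rfl, rfl, fun i hi => absurd hi (Nat.not_lt_zero i)⟩
    | @tail b c _ hbc ih =>
      obtain ⟨k, x, h0, hk, hx⟩ := ih
      refine ⟨k + 1, fun i => if i ≤ k then x i else c, by simpa using h0, by simp, fun i hi => ?_⟩
      rcases Nat.lt_succ_iff_lt_or_eq.1 hi with hi | rfl
      · simpa [hi.le, Nat.succ_le_iff.2 hi] using hx i hi
      · simpa [hk] using hbc
  obtain ⟨x, h0, hk, hx⟩ := Nat.find_spec hex
  refine ⟨Nat.find hex, x, h0, hk, hx, fun i j hij hj heq => ?_⟩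
  refine Nat.find_min hex (m := Nat.find hex - (j - i)) (by omega)
    -- The path that skips the positions between `i` and `j`, using `x i = x j`.
    ⟨fun m => if m ≤ i then x m else x (m + (j - i)), by simpa using h0, ?_, fun m hm => ?_⟩
  · by_cases hle : Nat.find hex - (j - i) ≤ i
    · have h1 : Nat.find hex - (j - i) = i := by omega
      have h2 : j = Nat.find hex := by omega
      simp only [hle, if_true]
      rw [h1, heq, h2, hk]
    · simp only [hle, if_false]
      rw [Nat.sub_add_cancel (by omega), hk]
  · rcases lt_trichotomy m i with hmi | rfl | hmi
    · simp only [hmi.le, Nat.succ_le_iff.2 hmi, if_true]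
      exact hx m (by omega)
    · have h1 : m + 1 + (j - m) = j + 1 := by omega
      have h2 : ¬ m + 1 ≤ m := by omega
      simp only [le_refl, if_true, h2, if_false, h1, heq]
      exact hx j (by omega)
    · have h1 : ¬ m ≤ i := by omega
      have h2 : ¬ m + 1 ≤ i := by omega
      simp only [h1, h2, if_false]
      rw [show m + 1 + (j - i) = m + (j - i) + 1 by omega]
      exact hx _ (by omega)

/-- Links acyclicity by edge sequences to directed paths: a vertex-simple path from the head of `e`
back to its tail, preceded by `e`, is a forbidden sequence of distinct edges. -/
theorem IsAcyclic.not_reflTransGen {f : g.PartialOrientation} (hf : f.IsAcyclic) {e : g.Edge}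
    {v w : V} (hv : f.1 e = some v) (hw : w ∈ g.ends e) (hwv : w ≠ v) :
    ¬ Relation.ReflTransGen f.Step v w := by
  intro h
  obtain ⟨k, x, h0, hk, hx, hinj⟩ := exists_injOn_path h
  have hinj' : ∀ i j, i ≤ k → j ≤ k → x i = x j → i = j := fun i j hi hj heq => by
    rcases lt_trichotomy i j with h | h | h
    · exact absurd heq (hinj i j h hj)
    · exact h
    · exact absurd heq.symm (hinj j i h hi)
  have hx' : ∀ i : Fin k, ∃ a : g.Edge, x (i + 1) ∈ g.ends a ∧ x i ∈ g.ends a ∧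
      (∀ y ∈ g.ends a, y = x i ∨ y = x (i + 1)) ∧
      (f.1 a = none ∨ f.1 a = some (x (i + 1))) := by
    intro i
    obtain ⟨a, h1, h2, hne, h3⟩ := hx i i.2
    refine ⟨a, h2, h1, fun y hy => ?_, h3⟩
    obtain ⟨p, q, _, hpq⟩ := mem_ends_cases a
    have e1 := (hpq _).1 h1
    have e2 := (hpq _).1 h2
    have e3 := (hpq _).1 hy
    rcases e1 with e1 | e1 <;> rcases e2 with e2 | e2 <;> rcases e3 with e3 | e3 <;>
      first
        | exact absurd (e1.trans e2.symm) hne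
        | exact Or.inl (e3.trans e1.symm)
        | exact Or.inr (e3.trans e2.symm)
  choose a ha1 ha0 hends ha using hx'
  have hkappa : ∀ i, x (i + 1) ∈ kappa f (a i) := fun i => by
    rcases ha i with h | h
    · rw [kappa_of_none h]; exact ha1 i
    · rw [kappa_of_some h]; rfl
  have hsub : ∀ i, kappa f (a i) ⊆ g.ends (a i) := fun i y hy => by
    rcases ha i with h | h
    · rwa [kappa_of_none h] at hy
    · rw [kappa_of_some h] at hy
      rw [Set.mem_singleton_iff.1 hy]; exact ha1 i
  let E : Fin (k + 1) → g.Edge := Fin.cons e a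
  -- Prepending `e` aligns the indices: the edge `E i` arrives at the vertex `x i`.
  have hE : ∀ i : Fin (k + 1), x i ∈ kappa f (E i) := by
    intro i
    induction i using Fin.cases with
    | zero => simp [E, kappa_of_some hv, h0]
    | succ i => simpa [E] using hkappa i
  refine hf ⟨k, E, ?_, fun i => ?_, w, ?_, ?_⟩
  · rw [Fin.cons_injective_iff]
    refine ⟨?_, fun i j hij => ?_⟩
    · rintro ⟨i, hi⟩
      rcases ha i with h | h
      · rw [hi, hv] at h
        cases h
      · rw [hi, hv, Option.some_inj, ← h0] at h
        have := hinj' 0 (i + 1) (by omega) i.2 h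
        omega
    · have h1 := hends j (x i) (hij ▸ ha0 i)
      have h2 := hends j (x (i + 1)) (hij ▸ ha1 i)
      have i2 := i.2
      have j2 := j.2
      rcases h1 with h1 | h1
      · exact Fin.ext (hinj' _ _ i2.le j2.le h1)
      · have h3 := hinj' _ _ i2.le j2 h1
        rcases h2 with h2 | h2
        · have := hinj' _ _ i2 j2.le h2
          omega
        · have := hinj' _ _ i2 j2 h2
          omega
  -- If the next edge is oriented, `x i` is in its source. If not, the previous edge meets it in `x
  -- i` but cannot contain `x (i + 1)`, as path vertices are distinct, so the intersection is
  -- proper.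
  · have hmem : x i ∈ kappa f (E i.castSucc) := by simpa using hE i.castSucc
    rcases ha i with h | h
    · refine Or.inr ⟨⟨x i, hmem, ha0 i⟩, ?_⟩
      have hk' : kappa f (E i.succ) = g.ends (E i.succ) := kappa_of_none h
      rw [hk']
      refine ⟨Set.inter_subset_right, fun hsup => ?_⟩
      have hmem' : x (i + 1) ∈ kappa f (E i.castSucc) := (hsup (ha1 i)).1
      have i2 := i.2
      rcases i with ⟨i, hi⟩
      cases i with
      | zero =>
        have h1 : x 1 ∈ kappa f e := hmem'
        rw [kappa_of_some hv, Set.mem_singleton_iff, ← h0] at h1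
        exact hinj 0 1 one_pos hi h1.symm
      | succ i =>
        have h1 : x (i + 1 + 1) ∈ kappa f (a ⟨i, by omega⟩) := hmem'
        rcases hends _ _ (hsub _ h1) with h2 | h2
        · have := hinj' _ _ hi (by omega) h2
          simp only at this
          omega
        · have := hinj' _ _ hi (by omega) h2
          simp at this
    · refine Or.inl ⟨x i, hmem, mem_source.2 ⟨_, h, ha0 i, ?_⟩⟩
      exact hinj _ _ (Nat.lt_succ_self _) i.2
  · have := hE (Fin.last k)
    rwa [Fin.val_last, hk] at this
  · exact mem_source.2 ⟨v, hv, hw, hwv⟩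

/-! ### The order on the components of `f(g)` and reciprocity for one orientation -/

/-- The relation on the components of `f(g)` induced by the oriented edges. -/
def ComponentRel (f : g.PartialOrientation) (C D : f.image.Component) : Prop :=
  ∃ e v w, f.1 e = some v ∧ w ∈ g.ends e ∧ w ≠ v ∧
    f.image.toSimple.connectedComponentMk w = C ∧ f.image.toSimple.connectedComponentMk v = D

theorem reflTransGen_of_mk_eq {f : g.PartialOrientation} {x y : V}
    (h : f.image.toSimple.connectedComponentMk x = f.image.toSimple.connectedComponentMk y) :
    Relation.ReflTransGen f.Step x y := by
  obtain ⟨p⟩ := SimpleGraph.ConnectedComponent.eq.1 h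
  clear h
  induction p with
  | nil => exact .refl
  | cons h _ ih =>
    obtain ⟨hne, a, ha, hx, hy⟩ := h
    obtain ⟨e, he, rfl⟩ := mem_image_edges.1 ha
    exact .head ⟨e, hx, hy, hne, Or.inl he⟩ ih

/-- Lifts a chain of components to directed paths in `g`. The first oriented edge is remembered,
since a contradiction with acyclicity needs one. -/
theorem exists_of_transGen {f : g.PartialOrientation} {C D : f.image.Component}
    (h : Relation.TransGen f.ComponentRel C D) :
    ∃ e v w, f.1 e = some v ∧ w ∈ g.ends e ∧ w ≠ v ∧
      f.image.toSimple.connectedComponentMk w = C ∧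
      ∀ y, f.image.toSimple.connectedComponentMk y = D → Relation.ReflTransGen f.Step v y := by
  induction h with
  | single h =>
    obtain ⟨e, v, w, hv, hw, hne, hC, hD⟩ := h
    exact ⟨e, v, w, hv, hw, hne, hC, fun y hy => reflTransGen_of_mk_eq (hD.trans hy.symm)⟩
  | tail _ h ih =>
    obtain ⟨e, v, w, hv, hw, hne, hC, hD⟩ := ih
    obtain ⟨e', v', w', hv', hw', hne', hC', hD'⟩ := h
    refine ⟨e, v, w, hv, hw, hne, hC, fun y hy => (hD w' hC').trans ?_⟩
    exact .head ⟨e', hw', f.2 _ _ hv', hne', Or.inr hv'⟩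
      (reflTransGen_of_mk_eq (hD'.trans hy.symm))

/-- A cycle of components would lift to a directed path from the head of an oriented edge back to
its tail. On a finite set, absence of cycles gives well-foundedness. -/
theorem IsAcyclic.wellFounded {f : g.PartialOrientation} (hf : f.IsAcyclic) :
    WellFounded (flip f.ComponentRel) := by
  have hirr : ∀ C, ¬ Relation.TransGen f.ComponentRel C C := fun C hC => by
    obtain ⟨e, v, w, hv, hw, hne, hwC, h⟩ := exists_of_transGen hC
    exact hf.not_reflTransGen hv hw hne (h w hwC)
  have : IsTrans f.image.Component (flip (Relation.TransGen f.ComponentRel)) :=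
    ⟨fun _ _ _ h h' => Relation.TransGen.trans h' h⟩
  have : Std.Irrefl (flip (Relation.TransGen f.ComponentRel)) := ⟨hirr⟩
  refine Subrelation.wf (r := flip (Relation.TransGen f.ComponentRel)) (fun h => .single h) ?_
  exact Finite.wellFounded_of_trans_of_irrefl _

theorem forall_mem_image_edges_iff {f : g.PartialOrientation} {p : V → V → Prop} :
    (∀ a ∈ f.image.edges, ∀ x y : V, (x : α) ∈ a → (y : α) ∈ a → p x y) ↔
      ∀ e, f.1 e = none → ∀ x ∈ g.ends e, ∀ y ∈ g.ends e, p x y := by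
  constructor
  · intro h e he x hx y hy
    exact h e.1 (mem_image_edges.2 ⟨e, he, rfl⟩) x y hx hy
  · intro h a ha x y hx hy
    obtain ⟨e, he, rfl⟩ := mem_image_edges.1 ha
    exact h e he x hx y hy

/-- Colorings constant on unoriented edges factor through the components. The relation `r` is kept
general to serve both `<` and `≤`. -/
theorem card_component_maps (f : g.PartialOrientation) (n : ℕ) (r : Fin n → Fin n → Prop) :
    Nat.card {c : f.image.Component → Fin n // ∀ C D, f.ComponentRel C D → r (c C) (c D)}
      = Nat.card {c : V → Fin n //
          ∀ e, (∀ v, f.1 e = some v → ∀ w ∈ g.ends e, w ≠ v → r (c w) (c v)) ∧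
            (f.1 e = none → ∀ v ∈ g.ends e, ∀ w ∈ g.ends e, c v = c w)} := by
  refine Nat.card_congr (Equiv.ofBijective
    (fun c => ⟨fun x => c.1 (f.image.toSimple.connectedComponentMk x), fun e => ⟨?_, ?_⟩⟩)
    ⟨?_, ?_⟩)
  · exact fun v hv w hw hne => c.2 _ _ ⟨e, v, w, hv, hw, hne, rfl, rfl⟩
  · intro he v hv w hw
    exact congrArg c.1 (connectedComponentMk_eq (mem_image_edges.2 ⟨e, he, rfl⟩) hv hw)
  · intro c c' h
    refine Subtype.ext (funext fun C => ?_)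
    induction C using SimpleGraph.ConnectedComponent.ind with
    | _ x => exact congrFun (congrArg Subtype.val h) x
  · rintro ⟨c, hc⟩
    obtain ⟨d, hd⟩ := exists_lift
      (forall_mem_image_edges_iff.2 fun e he x hx y hy => (hc e).2 he x hx y hy)
    refine ⟨⟨d, ?_⟩, Subtype.ext (funext hd)⟩
    rintro _ _ ⟨e, v, w, hv, hw, hne, rfl, rfl⟩
    rw [hd, hd]
    exact (hc e).1 v hv w hw hne

theorem card_strictColoring (f : g.PartialOrientation) (n : ℕ) :
    Nat.card (f.StrictColoring n)
      = Nat.card {c : f.image.Component → Fin n // ∀ C D, f.ComponentRel C D → c C < c D} := by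
  rw [card_component_maps f n (· < ·)]
  exact Nat.card_congr (Equiv.subtypeEquivRight fun c => isStrictlyCompatible_iff)

theorem card_coloring (f : g.PartialOrientation) (n : ℕ) :
    Nat.card (f.Coloring n)
      = Nat.card {c : f.image.Component → Fin n // ∀ C D, f.ComponentRel C D → c C ≤ c D} := by
  rw [card_component_maps f n (· ≤ ·)]
  refine Nat.card_congr (Equiv.subtypeEquivRight fun c => isCompatible_iff.trans ?_)
  refine forall_congr' fun e => and_congr_left' (forall₂_congr fun v _ => forall₂_congr fun w _ => ?_)
  exact ⟨fun h _ => h, fun h => (eq_or_ne w v).elim (fun hwv => hwv ▸ le_rfl) h⟩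

theorem IsAcyclic.exists_polynomial (K : Type*) [Field K] [CharZero K] {f : g.PartialOrientation}
    (hf : f.IsAcyclic) :
    ∃ P : K[X], (∀ n : ℕ, P.eval (n : K) = Nat.card (f.StrictColoring n)) ∧
      ∀ n : ℕ, P.eval (-(n : K)) = (-1) ^ f.image.cc * Nat.card (f.Coloring n) := by
  obtain ⟨P, h1, h2⟩ := OrderPolynomial.exists_polynomial K hf.wellFounded
  refine ⟨P, fun n => ?_, fun n => ?_⟩
  · rw [h1, card_strictColoring]
  · rw [h2, card_coloring, cc]

end GraphHopf.Multigraph.PartialOrientation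

/-! ### Double counting over orientations and flats -/

namespace GraphHopf.Multigraph

variable {α : Type u} {V : Finset α}

open PartialOrientation

-- Exchanging the two sums leaves, for each coloring, its unique strictly compatible orientation,
-- whose unoriented part is the monochromatic subgraph.
open scoped Classical in
theorem sum_acyclicOrientation {K : Type w} [Field K] (ζ : (graphMonoid.{u, w} K).Character)
    (g : Multigraph V) (n : ℕ) :
    ∑ f : g.AcyclicOrientation, ζ.toFun V (f.1.image.toG K) * (Nat.card (f.1.StrictColoring n) : K)
      = ∑ c : V → Fin n, ζ.toFun V ((g.mono c).toG K) := by
  have h1 : ∀ f : g.AcyclicOrientation,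
      ζ.toFun V (f.1.image.toG K) * (Nat.card (f.1.StrictColoring n) : K)
        = ∑ c : V → Fin n, if f.1.IsStrictlyCompatible c then ζ.toFun V (f.1.image.toG K) else 0 := by
    intro f
    rw [Nat.card_eq_fintype_card, Fintype.card_subtype, ← Finset.sum_filter, Finset.sum_const,
      nsmul_eq_mul, mul_comm]
  rw [Finset.sum_congr rfl fun f _ => h1 f, Finset.sum_comm]
  refine Finset.sum_congr rfl fun c _ => ?_
  obtain ⟨f, hf⟩ := exists_isStrictlyCompatible (g := g) c
  rw [Finset.sum_eq_single (⟨f, hf.isAcyclic⟩ : g.AcyclicOrientation), if_pos hf, hf.image_eq]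
  · intro f' _ hne
    exact if_neg fun hf' => hne (Subtype.ext (hf'.eq hf))
  · exact fun h => absurd (Finset.mem_univ _) h

/-- The orientation attached to a coloring is discrete exactly when the coloring is proper. -/
theorem sum_card_strictColoring_discrete (g : Multigraph V) (n : ℕ) :
    ∑ a : g.DiscreteAcyclicOrientation, Nat.card (a.1.StrictColoring n)
      = Nat.card {c : V → Fin n // (g.mono c).edges = 0} := by
  classical
  have h1 : ∀ a : g.DiscreteAcyclicOrientation, Nat.card (a.1.StrictColoring n)
      = ∑ c : V → Fin n, if a.1.IsStrictlyCompatible c then 1 else 0 := by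
    intro a
    rw [Nat.card_eq_fintype_card, Fintype.card_subtype, Finset.card_filter]
  rw [Finset.sum_congr rfl fun a _ => h1 a, Finset.sum_comm, Nat.card_eq_fintype_card,
    Fintype.card_subtype, Finset.card_filter]
  refine Finset.sum_congr rfl fun c _ => ?_
  obtain ⟨f, hf⟩ := exists_isStrictlyCompatible (g := g) c
  have hiff : (g.mono c).edges = 0 ↔ f.IsDiscrete := by
    rw [← hf.image_eq, image_edges_eq_zero_iff]
  by_cases hd : f.IsDiscrete
  · rw [if_pos (hiff.2 hd), Finset.sum_eq_single
      (⟨f, hd, hf.isAcyclic⟩ : g.DiscreteAcyclicOrientation), if_pos hf]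
    · intro f' _ hne
      exact if_neg fun hf' => hne (Subtype.ext (hf'.eq hf))
    · exact fun h => absurd (Finset.mem_univ _) h
  · rw [if_neg (mt hiff.1 hd)]
    refine Finset.sum_eq_zero fun a _ => if_neg fun ha => hd ?_
    rw [← IsStrictlyCompatible.eq ha hf]
    exact a.2.1

theorem IsFlat.le {g F : Multigraph V} (h : g.IsFlat F) : F.edges ≤ g.edges := by
  classical
  obtain ⟨n, D, _, h⟩ := h
  obtain ⟨c, rfl⟩ := colorClasses_bijective.2 D
  have h' : F = g.mono c := by
    rw [← decompose_colorClasses]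
    exact Multigraph.ext h
  rw [h']
  exact mono_edges_le g c

/-- The vertex of `g/F` given by a vertex of `g`. -/
noncomputable def quotientVertex (F : Multigraph V) (x : V) : quotientVertices F :=
  ⟨F.toSimple.connectedComponentMk x, @Finset.mem_univ _ (Fintype.ofFinite _) _⟩

theorem quotientVertex_surjective (F : Multigraph V) : Function.Surjective F.quotientVertex := by
  rintro ⟨C, hC⟩
  induction C using SimpleGraph.ConnectedComponent.ind with
  | _ x => exact ⟨x, rfl⟩

theorem mem_quotientEdge {F : Multigraph V} {e : Finset α} {x : quotientVertices F} :
    (x : F.Component) ∈ quotientEdge F e ↔ ∃ v : V, (v : α) ∈ e ∧ F.quotientVertex v = x := by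
  classical
  simp only [quotientEdge, Finset.mem_image, Finset.mem_subtype, quotientVertex, Subtype.ext_iff]

/-- A coloring pulled back from `g/F` is constant on the edges of `F`. Its monochromatic subgraph is
thus `F` plus the remaining edges whose images in `g/F` are monochromatic. -/
theorem mono_quotient_edges_eq_zero_iff (g : Multigraph V) (F : g.Flat) {n : ℕ}
    (d : quotientVertices F.1 → Fin n) :
    ((g.quotient F).mono d).edges = 0 ↔ g.mono (fun x => d (F.1.quotientVertex x)) = F.1 := by
  classical
  have h1 : ∀ e : Finset α, (∀ x y : quotientVertices F.1, (x : F.1.Component) ∈ quotientEdge F.1 e →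
      (y : F.1.Component) ∈ quotientEdge F.1 e → d x = d y) ↔
      ∀ x y : V, (x : α) ∈ e → (y : α) ∈ e →
        d (F.1.quotientVertex x) = d (F.1.quotientVertex y) := by
    intro e
    constructor
    · intro h x y hx hy
      exact h _ _ (mem_quotientEdge.2 ⟨x, hx, rfl⟩) (mem_quotientEdge.2 ⟨y, hy, rfl⟩)
    · intro h x y hx hy
      obtain ⟨v, hv, rfl⟩ := mem_quotientEdge.1 hx
      obtain ⟨w, hw, rfl⟩ := mem_quotientEdge.1 hy
      exact h v w hv hw
  have h2 : F.1.mono (fun x => d (F.1.quotientVertex x)) = F.1 :=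
    mono_eq_self fun e he x y hx hy =>
      congrArg d (Subtype.ext (connectedComponentMk_eq he hx hy))
  have h3 : F.1.edges + (g.edges - F.1.edges) = g.edges := add_tsub_cancel_of_le F.2.le
  have h4 : (g.mono (fun x => d (F.1.quotientVertex x))).edges = F.1.edges ↔
      ∀ e ∈ g.edges - F.1.edges, ¬ ∀ x y : V, (x : α) ∈ e → (y : α) ∈ e →
        d (F.1.quotientVertex x) = d (F.1.quotientVertex y) := by
    have h2' := congrArg edges h2
    simp only [mono] at h2' ⊢
    conv_lhs => rw [← h3, Multiset.filter_add, h2']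
    rw [add_eq_left, Multiset.filter_eq_nil]
  rw [Multigraph.ext_iff, h4, Multiset.eq_zero_iff_forall_notMem]
  simp only [mem_mono_edges, quotient, Multiset.mem_map, not_and, forall_exists_index, and_imp,
    forall_apply_eq_imp_iff₂, h1]

theorem card_mono_quotient (g : Multigraph V) (F : g.Flat) (n : ℕ) :
    Nat.card {d : quotientVertices F.1 → Fin n // ((g.quotient F).mono d).edges = 0}
      = Nat.card {c : V → Fin n // g.mono c = F.1} := by
  refine Nat.card_congr (Equiv.ofBijective (fun d => ⟨fun x => d.1 (F.1.quotientVertex x),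
    (mono_quotient_edges_eq_zero_iff g F d.1).1 d.2⟩) ⟨fun d d' h => ?_, ?_⟩)
  · refine Subtype.ext (funext fun C => ?_)
    obtain ⟨x, rfl⟩ := F.1.quotientVertex_surjective C
    exact congrFun (congrArg Subtype.val h) x
  · rintro ⟨c, hc⟩
    obtain ⟨d, hd⟩ := exists_lift (g := F.1) (c := c) fun e he => by
      rw [← hc] at he
      exact (mem_mono_edges.1 he).2
    refine ⟨⟨fun C => d C.1, ?_⟩, Subtype.ext (funext hd)⟩
    rw [mono_quotient_edges_eq_zero_iff]
    exact (mono_congr g fun x y => by simp only [quotientVertex, hd]).trans hc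

open scoped Classical in
theorem sum_flat {K : Type w} [Field K] (ζ : (graphMonoid.{u, w} K).Character)
    (g : Multigraph V) (n : ℕ) :
    ∑ F : g.Flat, ∑ a : (g.quotient F).DiscreteAcyclicOrientation,
        ζ.toFun V (F.1.toG K) * (Nat.card (a.1.StrictColoring n) : K)
      = ∑ c : V → Fin n, ζ.toFun V ((g.mono c).toG K) := by
  have h1 : ∀ F : g.Flat, ∑ a : (g.quotient F).DiscreteAcyclicOrientation,
        ζ.toFun V (F.1.toG K) * (Nat.card (a.1.StrictColoring n) : K)
      = ∑ c : V → Fin n, if g.mono c = F.1 then ζ.toFun V (F.1.toG K) else 0 := by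
    intro F
    rw [← Finset.mul_sum, ← Nat.cast_sum, sum_card_strictColoring_discrete, card_mono_quotient,
      Nat.card_eq_fintype_card, Fintype.card_subtype, ← Finset.sum_filter, Finset.sum_const,
      nsmul_eq_mul, mul_comm]
  rw [Finset.sum_congr rfl fun F _ => h1 F, Finset.sum_comm]
  refine Finset.sum_congr rfl fun c _ => ?_
  rw [Finset.sum_eq_single (⟨g.mono c, g.isFlat_mono c⟩ : g.Flat), if_pos rfl]
  · intro F _ hne
    exact if_neg fun h => hne (Subtype.ext h.symm)
  · exact fun h => absurd (Finset.mem_univ _) h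

/-- Applied to `g/F`, whose vertices are the components of `F`, this turns the reciprocity sign into
`(-1) ^ cc F`. -/
theorem PartialOrientation.IsDiscrete.cc_image {g : Multigraph V} {f : g.PartialOrientation}
    (hf : f.IsDiscrete) : f.image.cc = V.card := by
  have h0 := image_edges_eq_zero_iff.2 hf
  rw [cc, ← Nat.card_eq_finsetCard]
  refine (Nat.card_congr (Equiv.ofBijective f.image.toSimple.connectedComponentMk
    ⟨fun x y h => ?_, fun C => Quot.exists_rep C⟩)).symm
  obtain ⟨d, hd⟩ := exists_lift (g := f.image) (c := id) (by simp [h0])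
  exact (hd x).symm.trans ((congrArg d h).trans (hd y))

theorem card_quotientVertices (F : Multigraph V) : (quotientVertices F).card = F.cc :=
  (@Finset.card_univ _ (Fintype.ofFinite _)).trans
    (@Nat.card_eq_fintype_card _ (Fintype.ofFinite _)).symm

/-- Weights in `{0, 1}` turn the sum into a count of pairs; `p` stands for either kind of
compatibility. -/
theorem sum_acyclic_card {K : Type w} [Field K] {ζ : (graphMonoid.{u, w} K).Character}
    (hζ : IsCharacteristic ζ) {g : Multigraph V} {n : ℕ}
    (p : g.PartialOrientation → (V → Fin n) → Prop) :
    ∑ f : g.AcyclicOrientation,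
        ζ.toFun V (f.1.image.toG K) * (Nat.card {c : V → Fin n // p f.1 c} : K)
      = Nat.card {q : g.PartialOrientation × (V → Fin n) //
          q.1.IsAcyclic ∧ ζ.toFun V (q.1.image.toG K) ≠ 0 ∧ p q.1 q.2} := by
  have h : Nat.card {q : g.PartialOrientation × (V → Fin n) //
      q.1.IsAcyclic ∧ ζ.toFun V (q.1.image.toG K) ≠ 0 ∧ p q.1 q.2}
      = Nat.card (Σ f : g.AcyclicOrientation,
          {c : V → Fin n // ζ.toFun V (f.1.image.toG K) ≠ 0 ∧ p f.1 c}) :=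
    Nat.card_congr
      { toFun q := ⟨⟨q.1.1, q.2.1⟩, q.1.2, q.2.2⟩
        invFun f := ⟨(f.1.1, f.2.1), f.1.2, f.2.2⟩
        left_inv _ := rfl
        right_inv _ := rfl }
  rw [h, Nat.card_sigma, Nat.cast_sum]
  refine Finset.sum_congr rfl fun f _ => ?_
  rcases hζ f.1.image with h0 | h1
  · simp [h0]
  · simp [h1]

end GraphHopf.Multigraph

/-! ### The main theorem -/

theorem mainTheorem11 {K : Type w} [Field K] [CharZero K]
    (ζ : (GraphHopf.graphMonoid.{u, w} K).Character)
    {α : Type u} (V : Finset α) (g : GraphHopf.Multigraph V) :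
    (∀ n : ℕ,
      (GraphHopf.graphMonoid K).chi ζ (g.toG K) n
          = ∑ f : g.AcyclicOrientation,
              ζ.toFun V (f.1.image.toG K) * (Nat.card (f.1.StrictColoring n) : K) ∧
      (GraphHopf.graphMonoid K).chi ζ (g.toG K) n
          = ∑ F : g.Flat, ∑ a : (g.quotient F).DiscreteAcyclicOrientation,
              ζ.toFun V (F.1.toG K) * (Nat.card (a.1.StrictColoring n) : K)) ∧
    (GraphHopf.IsCharacteristic ζ → ∀ n : ℕ,
      (GraphHopf.graphMonoid K).chi ζ (g.toG K) n
          = (Nat.card {p : g.PartialOrientation × (V → Fin n) //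
              p.1.IsAcyclic ∧ ζ.toFun V (p.1.image.toG K) ≠ 0 ∧
                p.1.IsStrictlyCompatible p.2} : K)) ∧
    ∃ P : K[X],
      (∀ n : ℕ, P.eval (n : K) = (GraphHopf.graphMonoid K).chi ζ (g.toG K) n) ∧
      (∀ n : ℕ,
        P.eval (-(n : K))
            = ∑ f : g.AcyclicOrientation,
                (-1) ^ f.1.image.cc * ζ.toFun V (f.1.image.toG K) *
                  (Nat.card (f.1.Coloring n) : K) ∧
        P.eval (-(n : K))
            = ∑ F : g.Flat, ∑ a : (g.quotient F).DiscreteAcyclicOrientation,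
                (-1) ^ F.1.cc * ζ.toFun V (F.1.toG K) * (Nat.card (a.1.Coloring n) : K)) ∧
      (GraphHopf.IsCharacteristic ζ → GraphHopf.IsOdd ζ →
        (∀ n : ℕ,
          (-1) ^ V.card * P.eval (-(n : K))
            = (Nat.card {p : g.PartialOrientation × (V → Fin n) //
                p.1.IsAcyclic ∧ ζ.toFun V (p.1.image.toG K) ≠ 0 ∧ p.1.IsCompatible p.2} : K)) ∧
        (-1) ^ V.card * P.eval (-1)
          = (Nat.card {f : g.PartialOrientation //
              f.IsAcyclic ∧ ζ.toFun V (f.image.toG K) ≠ 0} : K)) := by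
  classical
  have hacyclic : ∀ n : ℕ, (GraphHopf.graphMonoid K).chi ζ (g.toG K) n
      = ∑ f : g.AcyclicOrientation,
          ζ.toFun V (f.1.image.toG K) * (Nat.card (f.1.StrictColoring n) : K) := fun n => by
    rw [GraphHopf.Multigraph.chi_toG, GraphHopf.Multigraph.sum_acyclicOrientation]
  have hflat : ∀ n : ℕ, (GraphHopf.graphMonoid K).chi ζ (g.toG K) n
      = ∑ F : g.Flat, ∑ a : (g.quotient F).DiscreteAcyclicOrientation,
          ζ.toFun V (F.1.toG K) * (Nat.card (a.1.StrictColoring n) : K) := fun n => by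
    rw [GraphHopf.Multigraph.chi_toG, GraphHopf.Multigraph.sum_flat]
  choose p hp hpneg using fun f : g.AcyclicOrientation => f.2.exists_polynomial K
  choose q hq hqneg using fun (F : g.Flat) (a : (g.quotient F).DiscreteAcyclicOrientation) =>
    a.2.2.exists_polynomial K
  let P : K[X] := ∑ f : g.AcyclicOrientation, Polynomial.C (ζ.toFun V (f.1.image.toG K)) * p f
  let Q : K[X] := ∑ F : g.Flat, ∑ a : (g.quotient F).DiscreteAcyclicOrientation,
    Polynomial.C (ζ.toFun V (F.1.toG K)) * q F a
  have hP : ∀ n : ℕ, P.eval (n : K) = (GraphHopf.graphMonoid K).chi ζ (g.toG K) n := fun n => by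
    simp only [P, hacyclic, Polynomial.eval_finsetSum, Polynomial.eval_mul, Polynomial.eval_C, hp]
  have hQ : ∀ n : ℕ, Q.eval (n : K) = (GraphHopf.graphMonoid K).chi ζ (g.toG K) n := fun n => by
    simp only [Q, hflat, Polynomial.eval_finsetSum, Polynomial.eval_mul, Polynomial.eval_C, hq]
  -- Both interpolate the invariant on `ℕ`, so the flat formula at negative arguments can be read
  -- off from `Q`.
  have hPQ : P = Q := by
    refine Polynomial.eq_of_infinite_eval_eq _ _ ?_
    refine (Set.infinite_range_of_injective (Nat.cast_injective (R := K))).mono ?_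
    rintro _ ⟨n, rfl⟩
    exact (hP n).trans (hQ n).symm
  have hPneg : ∀ n : ℕ, P.eval (-(n : K)) = ∑ f : g.AcyclicOrientation,
      (-1) ^ f.1.image.cc * ζ.toFun V (f.1.image.toG K) * (Nat.card (f.1.Coloring n) : K) := by
    intro n
    simp only [P, Polynomial.eval_finsetSum, Polynomial.eval_mul, Polynomial.eval_C, hpneg]
    exact Finset.sum_congr rfl fun f _ => by ring
  have hodd : GraphHopf.IsCharacteristic ζ → GraphHopf.IsOdd ζ → ∀ n : ℕ,
      (-1) ^ V.card * P.eval (-(n : K))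
        = (Nat.card {p : g.PartialOrientation × (V → Fin n) //
            p.1.IsAcyclic ∧ ζ.toFun V (p.1.image.toG K) ≠ 0 ∧ p.1.IsCompatible p.2} : K) := by
    intro hζ ho n
    rw [hPneg, Finset.mul_sum,
      ← GraphHopf.Multigraph.sum_acyclic_card hζ fun f c => f.IsCompatible c]
    refine Finset.sum_congr rfl fun f _ => ?_
    by_cases h0 : ζ.toFun V (f.1.image.toG K) = 0
    · simp [h0]
    · rw [← mul_assoc, ← mul_assoc, GraphHopf.Multigraph.neg_one_pow_cc ho _ h0, one_mul]
  refine ⟨fun n => ⟨hacyclic n, hflat n⟩, fun hζ n => ?_, P, hP, fun n => ⟨hPneg n, ?_⟩,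
    fun hζ ho => ⟨hodd hζ ho, ?_⟩⟩
  · rw [hacyclic]
    exact GraphHopf.Multigraph.sum_acyclic_card hζ fun f c => f.IsStrictlyCompatible c
  · rw [hPQ]
    simp only [Q, Polynomial.eval_finsetSum, Polynomial.eval_mul, Polynomial.eval_C, hqneg]
    refine Finset.sum_congr rfl fun F _ => Finset.sum_congr rfl fun a _ => ?_
    rw [a.2.1.cc_image, GraphHopf.Multigraph.card_quotientVertices]
    ring
  · have h := hodd hζ ho 1
    rw [Nat.cast_one] at h
    rw [h]
    congr 1
    -- With one color there is a single coloring, and it is compatible with every partial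
    -- orientation.
    refine Nat.card_congr
      { toFun p := ⟨p.1.1, p.2.1, p.2.2.1⟩
        invFun f := ⟨(f.1, fun _ => 0), f.2.1, f.2.2,
          GraphHopf.Multigraph.PartialOrientation.isCompatible_iff.2 fun e =>
            ⟨fun _ _ _ _ => le_rfl, fun _ _ _ _ _ => rfl⟩⟩
        left_inv p := Subtype.ext (Prod.ext rfl (Subsingleton.elim _ _))
        right_inv _ := rfl }
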